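/- Let $\mu=\mu_{1/4}$ be the Bernoulli convolution with scaling factor $\tfrac14$, i.e. the law of $\sum_{k\ge1}Y_k4^{-k}$ with $(Y_k)_{k\ge1}$ independent and $Y_k=\pm1$ with probability $\tfrac12$ each. For $t\in\mathbb R$ let $e_t(x)=e^{2\pi i t x}$, regarded as an element of $L^2(\mu)$, and let $\Gamma=\{\sum_{i=0}^m a_i4^i : m\ge 0,\ a_i\in\{0,1\}\}$. There is a unique unitary operator $U$ on $L^2(\mu)$ with $Ue_\gamma=e_{5\gamma}$ for all $\gamma\in\Gamma$, and there is a unique Borel projection-valued measure $E^U$ on the unit circle $\mathbb T$ with $U=\int_{\mathbb T}z\,E^U(dz)$. For $v\in L^2(\mu)$ let $m_v$ be the Borel measure $m_v(A)=\langle E^U(A)v,v\rangle$ on $\mathbb T$, and let $H(v)$ be the smallest closed subspace of $L^2(\mu)$ that contains $v$ and is invariant under both $U$ and $U^*$. For a Borel function $\phi:\mathbb T\to\mathbb C$ let $\phi(U)=\int_{\mathbb T}\phi(z)\,E^U(dz)$ be the (possibly unbounded) operator with domain $\{x\in L^2(\mu):\phi\in L^2(m_x)\}$; here $\phi(U)x=\lim_n\sum_{c}c\,E^U(\{s_n=c\})x$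 for any simple Borel functions $s_n$ converging to $\phi$ in $L^2(m_x)$. Then for every $v\in L^2(\mu)$ with $\|v\|=1$, $$H(v)=\{\phi(U)v : \phi\in L^2(m_v)\},$$ and the map $\phi\mapsto\phi(U)v$ is a well-defined isometric (linear) isomorphism of $L^2(m_v)$ onto $H(v)$. -/

import Mathlib

open MeasureTheory Filter Topology
open scoped ENNReal

noncomputable section

/-! ### The Bernoulli convolution, its exponentials and the index set `Γ` -/

/-- The law of a fair coin. -/
def fairCoin : Measure Bool :=
  (2⁻¹ : ℝ≥0∞) • Measure.dirac true + (2⁻¹ : ℝ≥0∞) • Measure.dirac false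

/-- The value `+1` or `-1` of a coin toss. -/
def coinSign (b : Bool) : ℝ := if b then 1 else -1

/-- The random variable `∑_{k ≥ 1} Y_k λ^k`, where `Y_k = ±1` is the outcome of the `k`-th toss. -/
def randomSeries (r : ℝ) (ω : ℕ → Bool) : ℝ := ∑' k : ℕ, coinSign (ω k) * r ^ (k + 1)

/-- The Bernoulli convolution with scaling factor `r`: the law of `∑_{k ≥ 1} ± r^k` for
independent fair signs. -/
def bernoulliConvolution (r : ℝ) : Measure ℝ :=
  (Measure.infinitePi fun _ : ℕ => fairCoin).map (randomSeries r)

instance instIsProbabilityMeasureFairCoin : IsProbabilityMeasure fairCoin :=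
  ⟨by simp [fairCoin, ENNReal.inv_two_add_inv_two]⟩

instance instIsFiniteMeasureBernoulliConvolution (r : ℝ) :
    IsFiniteMeasure (bernoulliConvolution r) := by
  unfold bernoulliConvolution; infer_instance

theorem measurable_randomSeries {r : ℝ} (hr : |r| < 1) : Measurable (randomSeries r) := by
  have hs : Summable fun k : ℕ => |r| ^ (k + 1) :=
    (summable_nat_add_iff 1).2 (summable_geometric_of_lt_one (abs_nonneg r) hr)
  refine Continuous.measurable (continuous_tsum (fun k => ?_) hs (fun k ω => ?_))
  · exact ((continuous_of_discreteTopology (f := coinSign)).comp (continuous_apply k)).mul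
      continuous_const
  · rw [norm_mul, norm_pow, Real.norm_eq_abs, Real.norm_eq_abs]
    refine mul_le_of_le_one_left (by positivity) ?_
    unfold coinSign; split <;> simp

/-- For `|r| < 1` the Bernoulli convolution is a probability measure. -/
theorem isProbabilityMeasure_bernoulliConvolution {r : ℝ} (hr : |r| < 1) :
    IsProbabilityMeasure (bernoulliConvolution r) :=
  Measure.isProbabilityMeasure_map (measurable_randomSeries hr).aemeasurable

/-- The measure `μ_{1/4}`. -/
abbrev muQuarter : Measure ℝ := bernoulliConvolution (1 / 4)

/-- The Hilbert space `L²(μ_{1/4})`. -/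
abbrev L2Quarter : Type := Lp ℂ 2 muQuarter

/-- The exponential function `e_t(x) = exp(2πitx)`. -/
def expFun (t : ℝ) (x : ℝ) : ℂ := Complex.exp (2 * Real.pi * Complex.I * t * x)

theorem memLp_expFun (t : ℝ) : MemLp (expFun t) 2 muQuarter := by
  have hc : Continuous (expFun t) := by unfold expFun; fun_prop
  refine MemLp.of_bound hc.aestronglyMeasurable 1 (ae_of_all _ fun x => le_of_eq ?_)
  have h : (2 * Real.pi * Complex.I * t * x : ℂ) = ((2 * Real.pi * t * x : ℝ) : ℂ) * Complex.I := by
    push_cast; ring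
  rw [expFun, h, Complex.norm_exp_ofReal_mul_I]

/-- The exponential `e_t` as an element of `L²(μ_{1/4})`. -/
def expL2 (t : ℝ) : L2Quarter := (memLp_expFun t).toLp (expFun t)

/-- The set `Γ = {∑_{i ≤ m} a_i 4^i : a_i ∈ {0, 1}, m finite} = {0, 1, 4, 5, 16, 17, …}`. -/
def Gam : Set ℕ :=
  {n | ∃ (m : ℕ) (a : ℕ → ℕ), (∀ i, a i ∈ ({0, 1} : Set ℕ)) ∧
    n = ∑ i ∈ Finset.range (m + 1), a i * 4 ^ i}

/-- `U` is a unitary operator on `L²(μ_{1/4})` with `U e_γ = e_{5γ}` for all `γ ∈ Γ`. -/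
def ScalesByFive (U : L2Quarter ≃ₗᵢ[ℂ] L2Quarter) : Prop :=
  ∀ g ∈ Gam, U (expL2 g) = expL2 (5 * g)

/-! ### Cyclic subspaces, projection-valued measures and spectral integrals -/

variable {S : Type*} [MeasurableSpace S]
variable {H : Type*} [NormedAddCommGroup H] [InnerProductSpace ℂ H] [CompleteSpace H]

/-- The `U`-cyclic subspace `H(v)`: the intersection of all closed subspaces containing `v` that
are invariant under `U` and under its adjoint. -/
def cyclicSubspace (U : H ≃ₗᵢ[ℂ] H) (v : H) : Submodule ℂ H :=
  sInf {K : Submodule ℂ H | IsClosed (K : Set H) ∧ v ∈ K ∧ (∀ x ∈ K, U x ∈ K) ∧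
    ∀ x ∈ K, ContinuousLinearMap.adjoint (U : H →L[ℂ] H) x ∈ K}

variable (S H) in
/-- A projection-valued measure on `S` with values in the orthogonal projections of `H`. As for
Mathlib's vector measures, the value at non-measurable sets is set to `0`; the series of
projections converges strongly. -/
structure ProjValuedMeasure where
  /-- The projection `E(A)`. -/
  proj : Set S → H →L[ℂ] H
  isStarProjection : ∀ A, MeasurableSet A → IsStarProjection (proj A)
  not_measurable : ∀ A, ¬ MeasurableSet A → proj A = 0
  proj_empty : proj ∅ = 0
  proj_univ : proj Set.univ = 1
  proj_mul_of_disjoint : ∀ A B, MeasurableSet A → MeasurableSet B → Disjoint A B →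
    proj A * proj B = 0
  hasSum_iUnion : ∀ A : ℕ → Set S, (∀ k, MeasurableSet (A k)) →
    Pairwise (Function.onFun Disjoint A) →
      ∀ x, HasSum (fun k => proj (A k) x) (proj (⋃ k, A k) x)

namespace ProjValuedMeasure

variable (E : ProjValuedMeasure S H)

theorem inner_proj_self (A : Set S) (x : H) :
    inner ℂ (E.proj A x) x = ((‖E.proj A x‖ ^ 2 : ℝ) : ℂ) := by
  by_cases hA : MeasurableSet A
  · have h := E.isStarProjection A hA
    have h1 : E.proj A (E.proj A x) = E.proj A x := by
      have := congrArg (fun T : H →L[ℂ] H => T x) h.isIdempotentElem.eq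
      simpa using this
    have h2 := ContinuousLinearMap.adjoint_inner_right (E.proj A) (E.proj A x) x
    have h3 : ContinuousLinearMap.adjoint (E.proj A) = E.proj A := h.isSelfAdjoint.star_eq
    calc inner ℂ (E.proj A x) x
        = inner ℂ (E.proj A (E.proj A x)) x := by rw [h1]
      _ = inner ℂ (E.proj A x) (E.proj A x) := by rw [← h2, h3]
      _ = _ := by rw [inner_self_eq_norm_sq_to_K]; push_cast; rfl
  · simp [E.not_measurable A hA]

/-- The scalar spectral measure `m_x(A) = ⟨E(A) x, x⟩` of `x`. -/
def scalarMeasure (x : H) : Measure S :=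
  Measure.ofMeasurable (fun A _ => ENNReal.ofReal (inner ℂ (E.proj A x) x).re)
    (by simp [E.proj_empty])
    (by
      intro A hA hd
      have hs := (E.hasSum_iUnion A hA hd x).mapL ((innerSL ℂ x : H →L[ℂ] ℂ))
      have hs' : HasSum (fun k => (inner ℂ (E.proj (A k) x) x).re)
          (inner ℂ (E.proj (⋃ k, A k) x) x).re := by
        have := Complex.hasSum_re hs
        have e : ∀ y : H, (innerSL ℂ x y).re = (inner ℂ y x).re := fun y => by
          rw [innerSL_apply_apply, ← inner_conj_symm, Complex.conj_re]
        simpa only [e] using this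
      rw [← hs'.tsum_eq, ENNReal.ofReal_tsum_of_nonneg _ hs'.summable]
      intro k
      rw [E.inner_proj_self, Complex.ofReal_re]
      positivity)

theorem scalarMeasure_apply {A : Set S} (hA : MeasurableSet A) (x : H) :
    E.scalarMeasure x A = ENNReal.ofReal (inner ℂ (E.proj A x) x).re :=
  Measure.ofMeasurable_apply A hA

theorem scalarMeasure_apply' {A : Set S} (hA : MeasurableSet A) (x : H) :
    E.scalarMeasure x A = ‖E.proj A x‖ₑ ^ 2 := by
  rw [E.scalarMeasure_apply hA, E.inner_proj_self, Complex.ofReal_re,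
    ENNReal.ofReal_pow (norm_nonneg _), ofReal_norm]

instance instIsFiniteMeasureScalarMeasure (x : H) : IsFiniteMeasure (E.scalarMeasure x) :=
  ⟨by rw [E.scalarMeasure_apply MeasurableSet.univ]; exact ENNReal.ofReal_lt_top⟩

theorem scalarMeasure_smul (c : ℂ) (x : H) :
    E.scalarMeasure (c • x) = ‖c‖ₑ ^ 2 • E.scalarMeasure x := by
  ext A hA
  simp [E.scalarMeasure_apply' hA, enorm_smul, mul_pow]

theorem scalarMeasure_add_le (x y : H) :
    E.scalarMeasure (x + y) ≤ (2 : ℝ≥0∞) • E.scalarMeasure x + (2 : ℝ≥0∞) • E.scalarMeasure y := by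
  refine Measure.le_iff.2 fun A hA => ?_
  simp only [Measure.add_apply, Measure.smul_apply, smul_eq_mul, E.scalarMeasure_apply' hA, map_add]
  rw [← mul_add]
  simp only [← ofReal_norm]
  rw [← ENNReal.ofReal_pow (norm_nonneg _), ← ENNReal.ofReal_pow (norm_nonneg _),
    ← ENNReal.ofReal_pow (norm_nonneg _), ← ENNReal.ofReal_add (by positivity) (by positivity),
    ← ENNReal.ofReal_ofNat, ← ENNReal.ofReal_mul (by norm_num)]
  refine ENNReal.ofReal_le_ofReal ?_
  have := norm_add_le (E.proj A x) (E.proj A y)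
  nlinarith [sq_nonneg (‖E.proj A x‖ - ‖E.proj A y‖), norm_nonneg (E.proj A x + E.proj A y)]

/-- The integral `∑_c c E({s = c})` of a simple function `s`. -/
def simpleIntegral (s : SimpleFunc S ℂ) : H →L[ℂ] H := ∑ c ∈ s.range, c • E.proj (s ⁻¹' {c})

/-- `w = (∫ f dE) x`: every sequence of simple functions `s_n` that converges to `f` in `L²(m_x)`
satisfies `(∫ s_n dE) x → w`. -/
def IsIntegralAt (f : S → ℂ) (x w : H) : Prop :=
  ∀ s : ℕ → SimpleFunc S ℂ,
    Tendsto (fun n => eLpNorm (⇑(s n) - f) 2 (E.scalarMeasure x)) atTop (𝓝 0) →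
      Tendsto (fun n => E.simpleIntegral (s n) x) atTop (𝓝 w)

theorem proj_union {A B : Set S} (hA : MeasurableSet A) (hB : MeasurableSet B)
    (hd : Disjoint A B) (x : H) : E.proj (A ∪ B) x = E.proj A x + E.proj B x := by
  have h := E.hasSum_iUnion (fun n => Nat.casesOn n A fun m => Nat.casesOn m B fun _ => ∅)
    (by rintro (_ | _ | k) <;> simp [hA, hB])
    (by rintro (_ | _ | i) (_ | _ | j) hij <;>
          simp_all [Function.onFun, disjoint_comm]) x
  have hU : (⋃ n, (Nat.casesOn n A fun m => Nat.casesOn m B fun _ => ∅ : Set S)) = A ∪ B := by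
    ext z
    simp only [Set.mem_iUnion, Set.mem_union]
    constructor
    · rintro ⟨_ | _ | k, hk⟩
      · exact Or.inl hk
      · exact Or.inr hk
      · exact hk.elim
    · rintro (hz | hz)
      · exact ⟨0, hz⟩
      · exact ⟨1, hz⟩
  rw [hU] at h
  have h2 := hasSum_sum_of_ne_finset_zero (f := fun n : ℕ =>
    E.proj (Nat.casesOn n A fun m => Nat.casesOn m B fun _ => ∅ : Set S) x)
    (s := Finset.range 2) (L := SummationFilter.unconditional ℕ) (by
      rintro (_ | _ | k) hk
      · simp at hk
      · simp at hk
      · simp [E.proj_empty])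
  simpa [Finset.sum_range_succ] using h.unique h2

theorem simpleIntegral_sub (s t : SimpleFunc S ℂ) (x : H) :
    E.simpleIntegral (s - t) x = E.simpleIntegral s x - E.simpleIntegral t x := by
  let T : Set S → ℂ →L[ℝ] H := fun A =>
    ((ContinuousLinearMap.toSpanSingleton ℂ (E.proj A x)) : ℂ →L[ℂ] H).restrictScalars ℝ
  have hT : FinMeasAdditive (0 : Measure S) T := by
    intro A B hA hB _ _ hd
    ext c
    simp [T, E.proj_union hA hB hd]
  have key : ∀ u : SimpleFunc S ℂ, E.simpleIntegral u x = SimpleFunc.setToSimpleFunc T u := by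
    intro u
    simp [simpleIntegral, SimpleFunc.setToSimpleFunc, T]
  rw [key, key, key, SimpleFunc.setToSimpleFunc_sub T hT (by simp) (by simp)]

theorem enorm_simpleIntegral (s : SimpleFunc S ℂ) (x : H) :
    ‖E.simpleIntegral s x‖ₑ = eLpNorm s 2 (E.scalarMeasure x) := by
  have horth : ∀ c d : ℂ, c ≠ d →
      inner ℂ (E.proj (s ⁻¹' {c}) x) (E.proj (s ⁻¹' {d}) x) = 0 := by
    intro c d hcd
    have hc := s.measurableSet_fiber c
    have hd := s.measurableSet_fiber d
    have h0 := E.proj_mul_of_disjoint _ _ hc hd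
      (Disjoint.preimage s (Set.disjoint_singleton.2 hcd))
    have h3 : ContinuousLinearMap.adjoint (E.proj (s ⁻¹' {c})) = E.proj (s ⁻¹' {c}) :=
      (E.isStarProjection _ hc).isSelfAdjoint.star_eq
    have h4 : E.proj (s ⁻¹' {c}) (E.proj (s ⁻¹' {d}) x) = 0 := by
      simpa using congrArg (fun T : H →L[ℂ] H => T x) h0
    rw [← ContinuousLinearMap.adjoint_inner_right, h3, h4, inner_zero_right]
  have hpyth : ∀ F : Finset ℂ, ‖∑ c ∈ F, c • E.proj (s ⁻¹' {c}) x‖ ^ 2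
      = ∑ c ∈ F, ‖c • E.proj (s ⁻¹' {c}) x‖ ^ 2 := by
    intro F
    induction F using Finset.induction_on with
    | empty => simp
    | insert a F ha ih =>
      rw [Finset.sum_insert ha, Finset.sum_insert ha, ← ih, sq, sq, sq]
      refine norm_add_sq_eq_norm_sq_add_norm_sq_of_inner_eq_zero (𝕜 := ℂ) _ _ ?_
      rw [inner_sum]
      refine Finset.sum_eq_zero fun c hc => ?_
      rw [inner_smul_left, inner_smul_right, horth a c (by rintro rfl; exact ha hc)]
      simp
  have hsq : ‖E.simpleIntegral s x‖ₑ ^ 2 = ∫⁻ z, ‖s z‖ₑ ^ 2 ∂(E.scalarMeasure x) := by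
    have h1 : ∫⁻ z, ‖s z‖ₑ ^ 2 ∂(E.scalarMeasure x)
        = ∑ c ∈ s.range, ‖c‖ₑ ^ 2 * E.scalarMeasure x (s ⁻¹' {c}) := by
      rw [← SimpleFunc.map_lintegral (fun c : ℂ => ‖c‖ₑ ^ 2) s, ← SimpleFunc.lintegral_eq_lintegral]
      rfl
    rw [h1, ← ofReal_norm, ← ENNReal.ofReal_pow (norm_nonneg _)]
    simp only [simpleIntegral, sum_apply, smul_apply]
    rw [hpyth, ENNReal.ofReal_sum_of_nonneg (fun _ _ => by positivity)]
    refine Finset.sum_congr rfl fun c _ => ?_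
    rw [ENNReal.ofReal_pow (norm_nonneg _), ofReal_norm, enorm_smul, mul_pow,
      E.scalarMeasure_apply' (s.measurableSet_fiber c)]
  rw [eLpNorm_eq_lintegral_rpow_enorm_toReal (by norm_num) (by norm_num)]
  simp only [ENNReal.toReal_ofNat, ENNReal.rpow_ofNat]
  rw [← hsq, one_div, ← ENNReal.rpow_ofNat, ← ENNReal.rpow_mul]
  norm_num

/-- Every measurable function is approximated by one sequence of simple functions in all spaces
`L²(m)` to which it belongs. -/
theorem exists_simpleFunc_tendsto {f : S → ℂ} (hf : Measurable f) :
    ∃ s : ℕ → SimpleFunc S ℂ, ∀ m : Measure S, MemLp f 2 m →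
      Tendsto (fun n => eLpNorm (⇑(s n) - f) 2 m) atTop (𝓝 0) :=
  ⟨fun n => SimpleFunc.approxOn f hf (Set.range f ∪ {0}) 0 (by simp) n, fun _ hm =>
    SimpleFunc.tendsto_approxOn_range_Lp_eLpNorm (by norm_num) hf hm.eLpNorm_lt_top⟩

theorem exists_isIntegralAt {f : S → ℂ} (hf : Measurable f) {x : H}
    (hx : MemLp f 2 (E.scalarMeasure x)) : ∃ w, E.IsIntegralAt f x w := by
  have hdist : ∀ s t : SimpleFunc S ℂ, edist (E.simpleIntegral s x) (E.simpleIntegral t x)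
      ≤ eLpNorm (⇑s - f) 2 (E.scalarMeasure x) + eLpNorm (⇑t - f) 2 (E.scalarMeasure x) := by
    intro s t
    rw [edist_eq_enorm_sub, ← E.simpleIntegral_sub, E.enorm_simpleIntegral, SimpleFunc.coe_sub]
    have e : (⇑s - ⇑t : S → ℂ) = (⇑s - f) - (⇑t - f) := by abel
    rw [e]
    exact eLpNorm_sub_le (s.measurable.sub hf).aestronglyMeasurable
      (t.measurable.sub hf).aestronglyMeasurable (by norm_num)
  obtain ⟨s, hs⟩ := exists_simpleFunc_tendsto hf
  have hs := hs _ hx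
  have hc : CauchySeq fun n => E.simpleIntegral (s n) x := by
    rw [EMetric.cauchySeq_iff]
    intro ε hε
    obtain ⟨N, hN⟩ := eventually_atTop.1 (hs.eventually_lt_const (ENNReal.half_pos hε.ne'))
    refine ⟨N, fun m hm n hn => (hdist _ _).trans_lt ?_⟩
    calc _ < ε / 2 + ε / 2 := ENNReal.add_lt_add (hN m hm) (hN n hn)
      _ = ε := ENNReal.add_halves ε
  obtain ⟨w, hw⟩ := cauchySeq_tendsto_of_complete hc
  refine ⟨w, fun t ht => ?_⟩
  rw [tendsto_iff_edist_tendsto_0] at hw ⊢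
  have h := (ht.add hs).add hw
  rw [add_zero, add_zero] at h
  exact tendsto_of_tendsto_of_tendsto_of_le_of_le tendsto_const_nhds h (fun _ => zero_le)
    (fun n => (edist_triangle _ (E.simpleIntegral (s n) x) _).trans (by gcongr; exact hdist _ _))

/-- The spectral integral `∫ f dE` of a Borel function `f`, as a (possibly unbounded) operator with
domain `{x : ∫ |f|² dm_x < ∞}`. -/
def integral (f : S → ℂ) (hf : Measurable f) : H →ₗ.[ℂ] H where
  domain :=
    { carrier := {x | MemLp f 2 (E.scalarMeasure x)}
      zero_mem' := by
        have h : E.scalarMeasure 0 = 0 := by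
          ext A hA; simp [E.scalarMeasure_apply' hA]
        simp [h]
      add_mem' := by
        intro x y hx hy
        refine MemLp.mono_measure (E.scalarMeasure_add_le x y) ⟨hf.aestronglyMeasurable, ?_⟩
        have hx' := (MemLp.smul_measure hx (c := 2) (by norm_num)).eLpNorm_lt_top
        have hy' := (MemLp.smul_measure hy (c := 2) (by norm_num)).eLpNorm_lt_top
        rw [eLpNorm_lt_top_iff_lintegral_rpow_enorm_lt_top (by norm_num) (by norm_num)] at hx' hy' ⊢
        rw [lintegral_add_measure]
        exact ENNReal.add_lt_top.2 ⟨hx', hy'⟩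
      smul_mem' := by
        intro c x hx
        change MemLp _ _ _
        rw [E.scalarMeasure_smul]
        exact MemLp.smul_measure hx (by simp) }
  toFun :=
    { toFun := fun x => Classical.choose (E.exists_isIntegralAt hf x.2)
      map_add' := by
        intro x y
        obtain ⟨s, hs⟩ := exists_simpleFunc_tendsto hf
        have hx := Classical.choose_spec (E.exists_isIntegralAt hf x.2) s (hs _ x.2)
        have hy := Classical.choose_spec (E.exists_isIntegralAt hf y.2) s (hs _ y.2)
        have hxy := Classical.choose_spec (E.exists_isIntegralAt hf (x + y).2) s (hs _ (x + y).2)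
        refine tendsto_nhds_unique hxy ((hx.add hy).congr fun n => ?_)
        simp
      map_smul' := by
        intro c x
        obtain ⟨s, hs⟩ := exists_simpleFunc_tendsto hf
        have hx := Classical.choose_spec (E.exists_isIntegralAt hf x.2) s (hs _ x.2)
        have hcx := Classical.choose_spec (E.exists_isIntegralAt hf (c • x).2) s (hs _ (c • x).2)
        refine tendsto_nhds_unique hcx ((hx.const_smul c).congr fun n => ?_)
        simp }

theorem mem_domain_integral {f : S → ℂ} {hf : Measurable f} {x : H} :
    x ∈ (E.integral f hf).domain ↔ MemLp f 2 (E.scalarMeasure x) := Iff.rfl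

theorem isIntegralAt_integral {f : S → ℂ} {hf : Measurable f} (x : (E.integral f hf).domain) :
    E.IsIntegralAt f x (E.integral f hf x) :=
  Classical.choose_spec (E.exists_isIntegralAt hf x.2)

end ProjValuedMeasure

/-! ### The spectral measure of a unitary operator -/

/-- The Borel `σ`-algebra of the unit circle. -/
instance instMeasurableSpaceCircle : MeasurableSpace Circle := borel Circle

instance instBorelSpaceCircle : BorelSpace Circle := ⟨rfl⟩

theorem measurable_circle_coe : Measurable fun z : Circle => (z : ℂ) :=
  Continuous.measurable (by fun_prop)

/-- `E` is the spectral measure of `U`, that is `U = ∫ z dE(z)`. -/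
def IsSpectralMeasure (U : H ≃ₗᵢ[ℂ] H) (E : ProjValuedMeasure Circle H) : Prop :=
  E.integral (fun z : Circle => (z : ℂ)) measurable_circle_coe =
    (U.toLinearEquiv : H →ₗ[ℂ] H).toPMap ⊤

end

noncomputable section

/-! ### The Fourier transform of `μ_{1/4}` -/

/-! Only the existence and uniqueness of `U` depend on `μ`. What is said about the spectral measure
and the cyclic subspaces holds for every unitary on a complex Hilbert space.

`U` exists and is unique because `{e_γ}` and `{e_{5γ}}`, with `γ ∈ Γ`, are both orthonormal bases.
Write `μ̂(t) = ∫ e_t dμ`. Self-similarity of `μ` gives `μ̂(t) = cos(πt/2) μ̂(t/4)`, so `μ̂` vanishes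
at odd integers, and then, for odd `d`, at every nonzero difference of elements of `dΓ`
(`fourierMu_gamSeq_sub`): this is orthogonality. For completeness with `d = 1, 5`, the Parseval sum
`q(t) = ∑_γ |μ̂(t - dγ)|²` is continuous, at most `1`, equal to `1` at `0`, and satisfies `q(t) =
cos²(πt/2) q(t/4) + sin²(πt/2) q((t - d)/4)`. A minimum argument forces `q = 1`
(`eq_one_of_functional_equation`). Hence every `e_t` lies in the closed span of `{e_{dγ}}`, and all
the `e_t` together are total by injectivity of the characteristic function.

A spectral measure exists because the continuous functional calculus of `U` yields, through
Riesz–Markov, a measure `m_x` with `‖Φ(f)x‖² = ∫ |f|² dm_x`. So `f ↦ Φ(f)x` extends isometrically to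
`L²(m_x)`, and the images of indicators are the projections. It is unique because the integrals of
polynomials in `z` and `z̄` are dictated by `U`, hence by Stone–Weierstrass those of continuous
functions, hence every `m_x`, hence every projection by polarization.

Finally `f ↦ (∫ f dE) v` is an isometry of `L²(m_v)` into `H` that turns multiplication by `z` into
`U` (`map_integralIsometry`). Its range is closed, contains `v` and is invariant under `U` and `U*`.
Conversely polynomials in `z`, `z̄` are dense in `L²(m_v)`, so every competing subspace contains the
range. Thus the range is `H(v)`. -/

theorem continuous_expFun (t : ℝ) : Continuous (expFun t) := by unfold expFun; fun_prop

theorem norm_expFun (t x : ℝ) : ‖expFun t x‖ = 1 := by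
  have h : (2 * Real.pi * Complex.I * t * x : ℂ) = ((2 * Real.pi * t * x : ℝ) : ℂ) * Complex.I := by
    push_cast; ring
  rw [expFun, h, Complex.norm_exp_ofReal_mul_I]

theorem star_expFun_mul (s t x : ℝ) : (starRingEnd ℂ) (expFun s x) * expFun t x
    = expFun (t - s) x := by
  unfold expFun
  rw [← Complex.exp_conj, ← Complex.exp_add]
  congr 1
  simp [map_ofNat]
  ring

instance instIsProbabilityMeasureMuQuarter : IsProbabilityMeasure muQuarter :=
  isProbabilityMeasure_bernoulliConvolution (by rw [abs_lt]; norm_num)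

/-- The Fourier transform `∫ e_t dμ` of `μ_{1/4}`. -/
def fourierMu (t : ℝ) : ℂ := ∫ x, expFun t x ∂muQuarter

theorem inner_expL2 (s t : ℝ) : inner ℂ (expL2 s) (expL2 t) = fourierMu (t - s) := by
  rw [L2.inner_def, fourierMu]
  refine integral_congr_ae ?_
  filter_upwards [(memLp_expFun s).coeFn_toLp, (memLp_expFun t).coeFn_toLp] with x hs ht
  change inner ℂ ((memLp_expFun s).toLp (expFun s) x) ((memLp_expFun t).toLp (expFun t) x) = _
  rw [hs, ht, RCLike.inner_apply', star_expFun_mul]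

theorem summable_coinSign (ω : ℕ → Bool) :
    Summable fun k : ℕ => coinSign (ω k) * (1 / 4 : ℝ) ^ (k + 1) := by
  have hs : Summable fun k : ℕ => (1 / 4 : ℝ) ^ (k + 1) :=
    (summable_nat_add_iff 1).2 (summable_geometric_of_lt_one (by norm_num) (by norm_num))
  refine Summable.of_norm_bounded hs fun k => ?_
  rw [norm_mul, norm_pow, Real.norm_eq_abs, Real.norm_eq_abs, abs_of_pos (by norm_num : (0:ℝ) < 1/4)]
  refine mul_le_of_le_one_left (by positivity) ?_
  unfold coinSign; split <;> simp

theorem integral_fairCoin (f : Bool → ℂ) : ∫ b, f b ∂fairCoin = (f true + f false) / 2 := by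
  rw [fairCoin, integral_add_measure (Integrable.of_finite.smul_measure (by simp))
    (Integrable.of_finite.smul_measure (by simp)), integral_smul_measure, integral_smul_measure]
  simp
  ring

theorem integral_expFun_coinSign (t r : ℝ) :
    ∫ b, expFun t (coinSign b * r) ∂fairCoin = Complex.cos (2 * Real.pi * t * r) := by
  rw [integral_fairCoin, Complex.cos]
  simp only [expFun, coinSign]
  congr 2
  · congr 1; simp; ring
  · congr 1; simp; ring

theorem expFun_sum {ι : Type*} (t : ℝ) (s : Finset ι) (f : ι → ℝ) :
    expFun t (∑ i ∈ s, f i) = ∏ i ∈ s, expFun t (f i) := by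
  simp only [expFun, ← Complex.exp_sum]
  push_cast
  rw [Finset.mul_sum]

/-- By independence of the signs, the transform of a partial sum of the random series is a product
of cosines. Dominated convergence passes to the full series. -/
theorem tendsto_prod_fourierMu (t : ℝ) :
    Tendsto (fun n : ℕ => ∏ k ∈ Finset.range n,
      Complex.cos (2 * Real.pi * t * ((1 / 4 : ℝ) ^ (k + 1) : ℝ))) atTop (𝓝 (fourierMu t)) := by
  have hpart : ∀ n : ℕ, ∫ ω : ℕ → Bool, expFun t (∑ k ∈ Finset.range n,
        coinSign (ω k) * (1 / 4 : ℝ) ^ (k + 1)) ∂(Measure.infinitePi fun _ : ℕ => fairCoin)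
      = ∏ k ∈ Finset.range n, Complex.cos (2 * Real.pi * t * ((1 / 4 : ℝ) ^ (k + 1) : ℝ)) := by
    intro n
    have hind := (ProbabilityTheory.iIndepFun_infinitePi (P := fun _ : ℕ => fairCoin)
      (X := fun k b => expFun t (coinSign b * (1 / 4 : ℝ) ^ (k + 1)))
      (fun k => measurable_of_finite _)).precomp (Fin.val_injective (n := n))
    have h := hind.integral_fun_prod_eq_prod_integral (fun i =>
      ((measurable_of_finite fun b => expFun t (coinSign b * (1 / 4 : ℝ) ^ ((i : ℕ) + 1))).comp
        (measurable_pi_apply (i : ℕ))).aestronglyMeasurable)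
    simp only [expFun_sum]
    rw [← Fin.prod_univ_eq_prod_range
      (fun k => Complex.cos (2 * Real.pi * t * ((1 / 4 : ℝ) ^ (k + 1) : ℝ)))]
    refine Eq.trans ?_ (h.trans (Finset.prod_congr rfl fun i _ => ?_))
    · refine integral_congr_ae (ae_of_all _ fun ω => ?_)
      exact (Fin.prod_univ_eq_prod_range
        (fun k => expFun t (coinSign (ω k) * (1 / 4 : ℝ) ^ (k + 1))) n).symm
    · rw [← integral_expFun_coinSign]
      have hmp := measurePreserving_eval_infinitePi (fun _ : ℕ => fairCoin) (i : ℕ)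
      rw [← hmp.map_eq, integral_map hmp.measurable.aemeasurable
        (measurable_of_finite _).aestronglyMeasurable, hmp.map_eq]
  simp only [← hpart]
  have hr : fourierMu t = ∫ ω, expFun t (randomSeries (1 / 4) ω)
      ∂(Measure.infinitePi fun _ : ℕ => fairCoin) := by
    rw [fourierMu, muQuarter, bernoulliConvolution, integral_map]
    · exact (measurable_randomSeries (by rw [abs_lt]; norm_num)).aemeasurable
    · exact (continuous_expFun t).aestronglyMeasurable
  rw [hr]
  refine tendsto_integral_of_dominated_convergence (fun _ => 1) (fun n => ?_)
    (integrable_const _) (fun n => ae_of_all _ fun ω => (norm_expFun _ _).le)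
    (ae_of_all _ fun ω => ?_)
  · refine ((continuous_expFun t).measurable.comp ?_).aestronglyMeasurable
    exact Finset.measurable_fun_sum _ fun k _ =>
      ((measurable_of_finite coinSign).comp (measurable_pi_apply k)).mul_const _
  · exact ((continuous_expFun t).tendsto _).comp (summable_coinSign ω).hasSum.tendsto_sum_nat

theorem fourierMu_zero : fourierMu 0 = 1 := by
  simp [fourierMu, expFun]

/-- Removing the first factor of the infinite cosine product leaves the same product at `t / 4`. -/
theorem fourierMu_eq_cos_mul (t : ℝ) :
    fourierMu t = (Real.cos (Real.pi * t / 2) : ℂ) * fourierMu (t / 4) := by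
  have h1 := (tendsto_add_atTop_iff_nat 1).2 (tendsto_prod_fourierMu t)
  have h2 := (tendsto_prod_fourierMu (t / 4)).const_mul (Real.cos (Real.pi * t / 2) : ℂ)
  refine tendsto_nhds_unique h1 (h2.congr fun n => ?_)
  rw [Finset.prod_range_succ', mul_comm]
  congr 1
  · refine Finset.prod_congr rfl fun k _ => ?_
    congr 1
    push_cast
    ring
  · push_cast
    congr 1
    ring

/-! ### The index set -/

/-- The `n`-th element of `Γ`: the binary digits of `n` read in base `4`. -/
def gamSeq (n : ℕ) : ℕ := Nat.ofDigits 4 (Nat.digits 2 n)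

theorem gamSeq_zero : gamSeq 0 = 0 := by simp [gamSeq]

theorem gamSeq_two_mul (n : ℕ) : gamSeq (2 * n) = 4 * gamSeq n := by
  rcases Nat.eq_zero_or_pos n with rfl | h
  · simp [gamSeq]
  · have := Nat.digits_add_two_add_one 0 (2 * n - 1)
    rw [Nat.sub_add_cancel (by omega)] at this
    simp only [gamSeq]
    rw [this, Nat.ofDigits_cons]
    simp

theorem gamSeq_two_mul_add_one (n : ℕ) : gamSeq (2 * n + 1) = 4 * gamSeq n + 1 := by
  have := Nat.digits_add_two_add_one 0 (2 * n)
  simp only [gamSeq]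
  rw [this, Nat.ofDigits_cons]
  simp
  rw [show (2 * n + 1) / 2 = n by omega]; omega

theorem gamSeq_eq_sum (m n : ℕ) (h : n < 2 ^ m) :
    ∃ a : ℕ → ℕ, (∀ i, a i ∈ ({0, 1} : Set ℕ)) ∧
      gamSeq n = ∑ i ∈ Finset.range m, a i * 4 ^ i := by
  induction m generalizing n with
  | zero => exact ⟨fun _ => 0, by simp, by simp [show n = 0 by simpa using h, gamSeq_zero]⟩
  | succ m ih =>
    rw [pow_succ] at h
    obtain ⟨a, ha, hs⟩ := ih (n / 2) (by omega)
    refine ⟨fun i => Nat.casesOn i (n % 2) a, ?_, ?_⟩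
    · rintro (_ | i)
      · have : n % 2 = 0 ∨ n % 2 = 1 := by omega
        simpa using this
      · exact ha i
    · rw [Finset.sum_range_succ']
      have e : ∑ k ∈ Finset.range m, a k * 4 ^ (k + 1) = 4 * gamSeq (n / 2) := by
        rw [hs, Finset.mul_sum]
        exact Finset.sum_congr rfl fun k _ => by ring
      simp only [e]
      rcases Nat.mod_two_eq_zero_or_one n with h0 | h0
      · have : n = 2 * (n / 2) := by omega
        conv_lhs => rw [this, gamSeq_two_mul]
        simp [h0]
      · have : n = 2 * (n / 2) + 1 := by omega
        conv_lhs => rw [this, gamSeq_two_mul_add_one]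
        simp [h0]

theorem sum_mem_range_gamSeq (m : ℕ) (a : ℕ → ℕ) (ha : ∀ i, a i ∈ ({0, 1} : Set ℕ)) :
    ∃ n, gamSeq n = ∑ i ∈ Finset.range m, a i * 4 ^ i := by
  induction m generalizing a with
  | zero => exact ⟨0, by simp [gamSeq_zero]⟩
  | succ m ih =>
    obtain ⟨n, hn⟩ := ih (fun i => a (i + 1)) (fun i => ha _)
    have e : ∑ k ∈ Finset.range m, a (k + 1) * 4 ^ (k + 1) = 4 * gamSeq n := by
      rw [hn, Finset.mul_sum]
      exact Finset.sum_congr rfl fun k _ => by ring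
    rw [Finset.sum_range_succ', e]
    rcases (by simpa using ha 0 : a 0 = 0 ∨ a 0 = 1) with h0 | h0
    · exact ⟨2 * n, by rw [gamSeq_two_mul, h0]; simp⟩
    · exact ⟨2 * n + 1, by rw [gamSeq_two_mul_add_one, h0]; simp⟩

theorem range_gamSeq : Set.range gamSeq = Gam := by
  ext g
  constructor
  · rintro ⟨n, rfl⟩
    -- A crude digit count is enough; it has the form `m + 1` because sums in `Gam` have at least
    -- one term.
    obtain ⟨a, ha, h⟩ := gamSeq_eq_sum (n + 1) n (Nat.lt_two_pow_self.trans (by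
      exact Nat.pow_lt_pow_right (by norm_num) (by omega)))
    exact ⟨n, a, ha, h⟩
  · rintro ⟨m, a, ha, rfl⟩
    exact sum_mem_range_gamSeq (m + 1) a ha

/-! ### The exponentials are total -/

/-- The finite measures `h⁺ μ` and `h⁻ μ` have the same characteristic function, so they coincide;
then `h⁺ = h⁻` almost everywhere, which forces `h = 0`. -/
theorem ae_eq_zero_of_forall_integral_expFun_mul {μ : Measure ℝ} [IsFiniteMeasure μ] {h : ℝ → ℝ}
    (hi : Integrable h μ) (h0 : ∀ t, ∫ x, expFun t x * (h x : ℂ) ∂μ = 0) : h =ᵐ[μ] 0 := by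
  have hfin : ∀ k : ℝ → ℝ, Integrable k μ →
      IsFiniteMeasure (μ.withDensity fun x => ENNReal.ofReal (k x)) := fun k hk =>
    isFiniteMeasure_withDensity_ofReal hk.2
  have hchar : ∀ k : ℝ → ℝ, Integrable k μ → ∀ t : ℝ,
      charFun (μ.withDensity fun x => ENNReal.ofReal (k x)) t
        = ∫ x, expFun (t / (2 * Real.pi)) x * (max (k x) 0 : ℝ) ∂μ := by
    intro k hk t
    rw [charFun_apply, integral_withDensity_eq_integral_toReal_smul₀
      hk.aestronglyMeasurable.aemeasurable.ennreal_ofReal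
      (ae_of_all _ fun _ => ENNReal.ofReal_lt_top)]
    refine integral_congr_ae (ae_of_all _ fun x => ?_)
    simp only [ENNReal.toReal_ofReal', Complex.real_smul, expFun]
    rw [mul_comm]
    congr 2
    have : (Real.pi : ℂ) ≠ 0 := by exact_mod_cast Real.pi_ne_zero
    simp
    field_simp
  have hint : ∀ k : ℝ → ℝ, Integrable k μ → ∀ t : ℝ,
      Integrable (fun x => expFun t x * (max (k x) 0 : ℝ)) μ := by
    intro k hk t
    refine Integrable.bdd_mul (c := 1) (Integrable.ofReal hk.pos_part)
      (continuous_expFun t).aestronglyMeasurable (ae_of_all _ fun x => (norm_expFun t x).le)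
  have heq : (μ.withDensity fun x => ENNReal.ofReal (h x))
      = μ.withDensity fun x => ENNReal.ofReal (-h x) := by
    have := hfin h hi
    have := hfin (fun x => -h x) hi.neg
    refine Measure.ext_of_charFun (funext fun t => ?_)
    rw [hchar h hi, hchar (fun x => -h x) hi.neg, ← sub_eq_zero,
      ← integral_sub (hint h hi _) (hint (fun x => -h x) hi.neg _),
      ← h0 (t / (2 * Real.pi))]
    refine integral_congr_ae (ae_of_all _ fun x => ?_)
    simp only
    rw [← mul_sub, ← Complex.ofReal_sub]
    congr 2
    rcases le_total (h x) 0 with hx | hx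
    · rw [max_eq_right hx, max_eq_left (by linarith)]; ring
    · rw [max_eq_left hx, max_eq_right (by linarith)]; ring
  rw [withDensity_eq_iff_of_sigmaFinite hi.aestronglyMeasurable.aemeasurable.ennreal_ofReal
    (g := fun x => ENNReal.ofReal (-h x))
    hi.neg.aestronglyMeasurable.aemeasurable.ennreal_ofReal] at heq
  filter_upwards [heq] with x hx
  have := congrArg ENNReal.toReal hx
  rw [ENNReal.toReal_ofReal', ENNReal.toReal_ofReal'] at this
  change h x = 0
  rcases le_total (h x) 0 with hx | hx
  · rw [max_eq_right hx, max_eq_left (by linarith)] at this; linarith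
  · rw [max_eq_left hx, max_eq_right (by linarith)] at this; linarith

theorem eq_zero_of_forall_inner_expL2 (f : L2Quarter) (h : ∀ t, inner ℂ (expL2 t) f = 0) :
    f = 0 := by
  have hi : Integrable f muQuarter := (Lp.memLp f).integrable (by norm_num)
  have hmul : ∀ t, Integrable (fun x => expFun t x * f x) muQuarter := fun t =>
    hi.bdd_mul (c := 1) (continuous_expFun t).aestronglyMeasurable
      (ae_of_all _ fun x => (norm_expFun t x).le)
  have hconj : ∀ t x, expFun (-t) x = (starRingEnd ℂ) (expFun t x) := by
    intro t x
    have := star_expFun_mul t 0 x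
    rw [zero_sub] at this
    rw [← this]
    simp [expFun]
  have h1 : ∀ t, ∫ x, expFun t x * f x ∂muQuarter = 0 := by
    intro t
    rw [← h (-t), L2.inner_def]
    refine integral_congr_ae ?_
    filter_upwards [(memLp_expFun (-t)).coeFn_toLp] with x hx
    change _ = inner ℂ ((memLp_expFun (-t)).toLp (expFun (-t)) x) _
    rw [hx, RCLike.inner_apply', hconj, Complex.conj_conj]
  -- Since `e_{-t}` is the conjugate of `e_t`, the hypothesis passes to the conjugate of `f`, hence
  -- to its real and imaginary parts, to which the real-valued lemma applies.
  have h2 : ∀ t, ∫ x, expFun t x * (starRingEnd ℂ) (f x) ∂muQuarter = 0 := by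
    intro t
    rw [← map_zero (starRingEnd ℂ), ← h1 (-t), ← integral_conj]
    simp [hconj]
  have hmul' : ∀ t, Integrable (fun x => expFun t x * (starRingEnd ℂ) (f x)) muQuarter := by
    intro t
    have := (hmul (-t))
    have h3 := (LinearIsometryEquiv.integrable_comp_iff (Complex.conjLIE)).2 this
    refine h3.congr (ae_of_all _ fun x => ?_)
    simp [hconj]
  have hre : (fun x => (f x).re) =ᵐ[muQuarter] 0 := by
    refine ae_eq_zero_of_forall_integral_expFun_mul hi.re fun t => ?_
    have : ∀ x, expFun t x * ((f x).re : ℂ)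
        = (2⁻¹ : ℂ) * (expFun t x * f x + expFun t x * (starRingEnd ℂ) (f x)) := by
      intro x
      rw [Complex.re_eq_add_conj]; ring
    simp only [this]
    rw [integral_const_mul, integral_add (hmul t) (hmul' t), h1, h2]
    simp
  have him : (fun x => (f x).im) =ᵐ[muQuarter] 0 := by
    refine ae_eq_zero_of_forall_integral_expFun_mul hi.im fun t => ?_
    have : ∀ x, expFun t x * ((f x).im : ℂ)
        = (2 * Complex.I)⁻¹ * (expFun t x * f x - expFun t x * (starRingEnd ℂ) (f x)) := by
      intro x
      rw [Complex.im_eq_sub_conj]; ring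
    simp only [this]
    rw [integral_const_mul, integral_sub (hmul t) (hmul' t), h1, h2]
    simp
  refine (Lp.eq_zero_iff_ae_eq_zero).2 ?_
  filter_upwards [hre, him] with x h1 h2
  exact Complex.ext h1 h2

theorem continuous_expL2 : Continuous expL2 := by
  have hc : Continuous fourierMu := by
    refine continuous_of_dominated (F := fun t x => expFun t x) (bound := fun _ => 1)
      (fun t => (continuous_expFun t).aestronglyMeasurable)
      (fun t => ae_of_all _ fun x => (norm_expFun t x).le) (integrable_const _)
      (ae_of_all _ fun x => ?_)
    unfold expFun; fun_prop
  rw [continuous_iff_continuousAt]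
  intro s
  rw [ContinuousAt, tendsto_iff_norm_sub_tendsto_zero]
  have hsq : Tendsto (fun t => ‖expL2 t - expL2 s‖ ^ 2) (𝓝 s) (𝓝 0) := by
    -- Continuity of `expL2` thus reduces to that of `fourierMu` at `0`.
    have e : ∀ t, ‖expL2 t - expL2 s‖ ^ 2 = 2 - 2 * (fourierMu (s - t)).re := by
      intro t
      rw [@norm_sub_sq ℂ, inner_expL2, ← @inner_self_eq_norm_sq ℂ, ← @inner_self_eq_norm_sq ℂ,
        inner_expL2, inner_expL2, sub_self, sub_self, fourierMu_zero]
      simp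
      ring
    simp only [e]
    have : Tendsto (fun t => 2 - 2 * (fourierMu (s - t)).re) (𝓝 s)
        (𝓝 (2 - 2 * (fourierMu (s - s)).re)) := by
      refine Continuous.tendsto (f := fun t => 2 - 2 * (fourierMu (s - t)).re) ?_ s
      fun_prop
    simpa [fourierMu_zero] using this
  have := hsq.sqrt
  simpa using this

theorem norm_expL2 (t : ℝ) : ‖expL2 t‖ = 1 := by
  have : ‖expL2 t‖ ^ 2 = 1 := by
    rw [← @inner_self_eq_norm_sq ℂ, inner_expL2, sub_self, fourierMu_zero]; simp
  nlinarith [norm_nonneg (expL2 t)]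

/-! ### Bessel operators -/

section Bessel

variable {E : Type*} [NormedAddCommGroup E] [InnerProductSpace ℂ E] [CompleteSpace E]

/-- With `A` the adjoint of the isometry `T : ℓ² → E` defined by `v`, the Bessel sum is `‖A x‖²`,
which makes its continuity in `x` immediate. From `‖x - T A x‖² = ‖x‖² - ‖A x‖²`, equality in
Bessel's inequality means `x = T A x`, so `x` is orthogonal to whatever `v` is orthogonal to. -/
theorem Orthonormal.exists_bessel {v : ℕ → E} (hv : Orthonormal ℂ v) :
    ∃ Q : E → ℝ, Continuous Q ∧ (∀ x, HasSum (fun n => ‖inner ℂ (v n) x‖ ^ 2) (Q x)) ∧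
      (∀ x, Q x ≤ ‖x‖ ^ 2) ∧
      ∀ x, Q x = ‖x‖ ^ 2 → ∀ f, (∀ n, inner ℂ (v n) f = 0) → inner ℂ x f = 0 := by
  let V : lp (fun _ : ℕ => ℂ) 2 →ₗᵢ[ℂ] E := hv.orthogonalFamily.linearIsometry
  let T : lp (fun _ : ℕ => ℂ) 2 →L[ℂ] E := V.toContinuousLinearMap
  let A := ContinuousLinearMap.adjoint T
  have hA : ∀ x n, (A x : ∀ _ : ℕ, ℂ) n = inner ℂ (v n) x := by
    intro x n
    have h := ContinuousLinearMap.adjoint_inner_right T (lp.single 2 n (1 : ℂ)) x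
    rw [lp.inner_single_left] at h
    have h2 : T (lp.single 2 n (1 : ℂ)) = v n := by
      change V _ = _
      simp [V, OrthogonalFamily.linearIsometry_apply_single]
    rw [h2] at h
    simpa using h
  have hTA : ∀ x, inner ℂ (T (A x)) x = ((‖A x‖ ^ 2 : ℝ) : ℂ) := by
    intro x
    rw [← ContinuousLinearMap.adjoint_inner_right, inner_self_eq_norm_sq_to_K]
    push_cast; rfl
  have hnorm : ∀ x, ‖x - T (A x)‖ ^ 2 = ‖x‖ ^ 2 - ‖A x‖ ^ 2 := by
    intro x
    have hT : ‖T (A x)‖ = ‖A x‖ := V.norm_map _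
    rw [@norm_sub_sq ℂ, ← inner_conj_symm, hTA, hT]
    simp
    norm_cast
    ring
  refine ⟨fun x => ‖A x‖ ^ 2, by fun_prop, fun x => ?_, fun x => ?_, fun x hx f hf => ?_⟩
  · have := lp.hasSum_norm (p := 2) (by norm_num) (A x)
    simpa [hA] using this
  · have := hnorm x
    nlinarith [sq_nonneg ‖x - T (A x)‖]
  · have h1 := hnorm x
    simp only at hx
    rw [hx, sub_self, sq_eq_zero_iff, norm_eq_zero, sub_eq_zero] at h1
    have h2 : A f = 0 := by
      ext n
      rw [hA, hf]; rfl
    rw [h1, ← ContinuousLinearMap.adjoint_inner_right]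
    change inner ℂ _ (A f) = 0
    rw [h2, inner_zero_right]

end Bessel

/-! ### Orthonormality and completeness of `{e_{dγ}}` -/

theorem fourierMu_eq_zero_of_odd {s : ℝ} (k : ℤ) (h : s = 2 * k + 1) : fourierMu s = 0 := by
  rw [fourierMu_eq_cos_mul, Real.cos_eq_zero_iff.2 ⟨k, by rw [h]; ring⟩]
  simp

/-- Descent on the last base-4 digit. If the last digits differ, the frequency is odd and
`fourierMu` vanishes there; if they agree, they cancel and the functional equation divides the
frequency by `4`. -/
theorem fourierMu_gamSeq_sub {d : ℕ} (hd : Odd d) (m n : ℕ) (h : m ≠ n) :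
    fourierMu (d * gamSeq m - d * gamSeq n) = 0 := by
  obtain ⟨j, rfl⟩ := hd
  induction hN : m + n using Nat.strong_induction_on generalizing m n with
  | _ N ih =>
    rcases Nat.even_or_odd' m with ⟨a, rfl | rfl⟩ <;> rcases Nat.even_or_odd' n with ⟨b, rfl | rfl⟩
    · have := ih (a + b) (by omega) a b (by omega) rfl
      rw [fourierMu_eq_cos_mul, gamSeq_two_mul, gamSeq_two_mul]
      refine mul_eq_zero_of_right _ (Eq.trans (congrArg _ ?_) this)
      push_cast; ring
    · rw [gamSeq_two_mul, gamSeq_two_mul_add_one]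
      refine fourierMu_eq_zero_of_odd (2 * (2 * j + 1) * (gamSeq a - gamSeq b) - j - 1) ?_
      push_cast; ring
    · rw [gamSeq_two_mul, gamSeq_two_mul_add_one]
      refine fourierMu_eq_zero_of_odd (2 * (2 * j + 1) * (gamSeq a - gamSeq b) + j) ?_
      push_cast; ring
    · have := ih (a + b) (by omega) a b (by omega) rfl
      rw [fourierMu_eq_cos_mul, gamSeq_two_mul_add_one, gamSeq_two_mul_add_one]
      refine mul_eq_zero_of_right _ (Eq.trans (congrArg _ ?_) this)
      push_cast; ring

theorem orthonormal_expL2_gamSeq {d : ℕ} (hd : Odd d) :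
    Orthonormal ℂ fun n => expL2 (d * gamSeq n) := by
  refine ⟨fun n => norm_expL2 _, fun m n hmn => ?_⟩
  simp only [inner_expL2]
  exact fourierMu_gamSeq_sub hd n m hmn.symm

/-- A continuous solution `q ≤ 1` of the functional equation of `t ↦ ∑_γ |μ̂(t - dγ)|²` with
`q 0 = 1` is constant: its minimizers on a large interval are stable under the branches `t / 4` and
`(t - d) / 4` of nonzero weight, so that `0` is one of them. -/
theorem eq_one_of_functional_equation {d : ℕ} (hd : d = 1 ∨ d = 5) {q : ℝ → ℝ} (hc : Continuous q)
    (h0 : q 0 = 1) (h1 : ∀ t, q t ≤ 1)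
    (hq : ∀ t, q t = Real.cos (Real.pi * t / 2) ^ 2 * q (t / 4)
      + Real.sin (Real.pi * t / 2) ^ 2 * q ((t - d) / 4)) (t : ℝ) : q t = 1 := by
  have hd5 : (d : ℝ) ≤ 5 := by rcases hd with rfl | rfl <;> norm_num
  have hd0 : (0 : ℝ) ≤ d := by positivity
  -- The interval `[-R, R]` contains `t`, and `d ≤ 5 ≤ R` makes it stable under both branches.
  set R := max |t| 5 with hR
  have hR5 : 5 ≤ R := le_max_right _ _
  obtain ⟨t₀, ht₀, hmin⟩ := (isCompact_Icc (a := -R) (b := R)).exists_isMinOn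
    ⟨0, by constructor <;> linarith⟩ hc.continuousOn
  have hmin' : ∀ s, |s| ≤ R → q t₀ ≤ q s := fun s hs => hmin (abs_le.1 hs)
  set m := q t₀ with hm
  let M := {s : ℝ | |s| ≤ R ∧ q s = m}
  have hMc : IsCompact M := by
    refine (isCompact_Icc (a := -R) (b := R)).of_isClosed_subset ?_ fun s hs => abs_le.1 hs.1
    exact (isClosed_le continuous_abs continuous_const).inter (isClosed_eq hc continuous_const)
  -- Among all minimizers of `q` on the interval, `u` has the least absolute value; the goal is `u =
  -- 0`.
  obtain ⟨u, hu, humin⟩ := hMc.exists_isMinOn ⟨t₀, abs_le.2 ht₀, rfl⟩ continuous_abs.continuousOn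
  have humin' : ∀ s ∈ M, |u| ≤ |s| := fun s hs => humin hs
  have hX1 : ∀ s : ℝ, |s| ≤ R → |s / 4| ≤ R := by
    intro s hs; rw [abs_le] at *; constructor <;> linarith
  have hX2 : ∀ s : ℝ, |s| ≤ R → |(s - d) / 4| ≤ R := by
    intro s hs; rw [abs_le] at *; constructor <;> linarith
  -- The value `q s = m` is a convex combination of two values that are at least `m`, so a branch of
  -- positive weight attains `m`.
  have hcos : ∀ s ∈ M, Real.cos (Real.pi * s / 2) ≠ 0 → s / 4 ∈ M := by
    intro s hs hne
    refine ⟨hX1 s hs.1, ?_⟩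
    have a1 := hmin' _ (hX1 s hs.1)
    have a2 := hmin' _ (hX2 s hs.1)
    have a3 := hq s
    rw [hs.2] at a3
    have a4 := Real.sin_sq_add_cos_sq (Real.pi * s / 2)
    have a5 : 0 < Real.cos (Real.pi * s / 2) ^ 2 := by positivity
    have a6 : Real.cos (Real.pi * s / 2) ^ 2 * (q (s / 4) - m) ≤ 0 := by
      have : Real.sin (Real.pi * s / 2) ^ 2 * (q ((s - d) / 4) - m) ≥ 0 :=
        mul_nonneg (sq_nonneg _) (by linarith)
      have : Real.cos (Real.pi * s / 2) ^ 2 * (q (s / 4) - m)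
          + Real.sin (Real.pi * s / 2) ^ 2 * (q ((s - d) / 4) - m) = 0 := by
        linear_combination -a3 - m * a4
      linarith
    nlinarith
  have hsin : ∀ s ∈ M, Real.cos (Real.pi * s / 2) = 0 → (s - d) / 4 ∈ M := by
    intro s hs h0
    refine ⟨hX2 s hs.1, ?_⟩
    have a3 := hq s
    have a4 := Real.sin_sq_add_cos_sq (Real.pi * s / 2)
    rw [h0] at a3 a4
    rw [hs.2, show Real.sin (Real.pi * s / 2) ^ 2 = 1 by linarith] at a3
    linarith
  have huz : u = 0 := by
    by_contra hne
    have hpos : 0 < |u| := abs_pos.2 hne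
    by_cases hcu : Real.cos (Real.pi * u / 2) = 0
    · have a1 := humin' _ (hsin u hu hcu)
      -- This gives `|u| ≤ d / 3 ≤ 5 / 3`. As `cos(πu/2) = 0` makes `u` an odd integer, `u = ±1`,
      -- which is already too large for `d = 1`.
      have a2 : |u| ≤ (|u| + d) / 4 := by
        refine a1.trans ?_
        rw [abs_div, abs_of_pos (by norm_num : (0 : ℝ) < 4)]
        have := abs_sub u d
        rw [abs_of_nonneg hd0] at this
        linarith
      obtain ⟨k, hk⟩ := Real.cos_eq_zero_iff.1 hcu
      have hk' : u = 2 * k + 1 := by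
        have := Real.pi_ne_zero
        field_simp at hk
        linarith
      have hk2 : k = 0 ∨ k = -1 := by
        have h3 : |u| ≤ 5 / 3 := by linarith
        rw [abs_le, hk'] at h3
        have h4 : (-2 : ℝ) < k := by linarith [h3.1]
        have h5 : (k : ℝ) < 1 := by linarith [h3.2]
        have h4' : -2 < k := by exact_mod_cast h4
        have h5' : k < 1 := by exact_mod_cast h5
        omega
      have habs : |u| = 1 := by
        rcases hk2 with rfl | rfl <;> rw [hk'] <;> norm_num
      rcases hd with rfl | rfl
      · rw [habs] at a2; norm_num at a2
      -- For `d = 5` the sine branch sends `1` to `-1` and `-1` to `-3/2`. There the cosine is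
      -- nonzero, so `-3/8 ∈ M`, which is closer to `0` than `u`.
      · have hneg : (-1 : ℝ) ∈ M := by
          have := hsin u hu hcu
          rcases hk2 with rfl | rfl
          · rw [hk'] at this; norm_num at this; exact this
          · rw [hk'] at hu; norm_num at hu; exact hu
        have hb := hsin _ hneg (Real.cos_eq_zero_iff.2 ⟨-1, by push_cast; ring⟩)
        have hc := hcos _ hb (by
          intro h
          obtain ⟨l, hl⟩ := Real.cos_eq_zero_iff.1 h
          have := Real.pi_ne_zero
          field_simp at hl
          norm_num at hl
          have h6 : (-3 : ℤ) = 2 * (2 * l + 1) := by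
            have : (-3 : ℝ) = 2 * (2 * l + 1) := by linarith
            exact_mod_cast this
          omega)
        have := humin' _ hc
        rw [habs] at this
        norm_num [abs_of_neg, abs_of_pos] at this
    · have := humin' _ (hcos u hu hcu)
      rw [abs_div, abs_of_pos (by norm_num : (0 : ℝ) < 4)] at this
      linarith
  have hm1 : m = 1 := by rw [← hu.2, huz, h0]
  exact le_antisymm (h1 t) (hm1 ▸ hmin' t (le_max_left _ _))

theorem eq_zero_of_forall_inner_expL2_gamSeq {d : ℕ} (hd : d = 1 ∨ d = 5) (f : L2Quarter)
    (hf : ∀ n, inner ℂ (expL2 (d * gamSeq n)) f = 0) : f = 0 := by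
  have hodd : Odd d := by rcases hd with rfl | rfl <;> decide
  obtain ⟨Q, hQc, hQs, hQle, hQ⟩ := (orthonormal_expL2_gamSeq hodd).exists_bessel
  refine eq_zero_of_forall_inner_expL2 f fun t => hQ _ ?_ f hf
  rw [norm_expL2, one_pow]
  have hs : ∀ t : ℝ, HasSum (fun n => ‖fourierMu (t - d * gamSeq n)‖ ^ 2) (Q (expL2 t)) := by
    intro t
    simpa only [inner_expL2] using hQs (expL2 t)
  have hle : ∀ t, Q (expL2 t) ≤ 1 := fun t => by simpa [norm_expL2] using hQle (expL2 t)
  refine eq_one_of_functional_equation (q := fun t => Q (expL2 t)) hd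
    (hQc.comp continuous_expL2) (le_antisymm (hle 0) ?_) hle (fun t => ?_) t
  · have := le_hasSum (hs 0) 0 (fun _ _ => by positivity)
    simpa [gamSeq_zero, fourierMu_zero] using this
  · obtain ⟨j, hj⟩ := hodd
    -- Even and odd indices are the elements of `Γ` with last base-4 digit `0` and `1`; they produce
    -- the two terms of the functional equation.
    refine (hs t).unique (HasSum.even_add_odd ?_ ?_)
    · refine ((hs (t / 4)).mul_left (Real.cos (Real.pi * t / 2) ^ 2)).congr_fun fun n => ?_
      rw [gamSeq_two_mul, fourierMu_eq_cos_mul, norm_mul, mul_pow, Complex.norm_real,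
        Real.norm_eq_abs, sq_abs]
      congr 2
      · rw [← Real.cos_add_int_mul_two_pi _ (d * gamSeq n)]
        congr 1; push_cast; ring
      · congr 2; push_cast; ring
    · refine ((hs ((t - d) / 4)).mul_left (Real.sin (Real.pi * t / 2) ^ 2)).congr_fun fun n => ?_
      rw [gamSeq_two_mul_add_one, fourierMu_eq_cos_mul, norm_mul, mul_pow, Complex.norm_real,
        Real.norm_eq_abs, sq_abs]
      congr 1
      -- Modulo `2π` the angle moves by `dπ/2 = π/2 + jπ`: the quarter turn changes cosine into
      -- sine, and squaring removes the sign `(-1)^j`.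
      · have : Real.pi * (t - d * ((4 * gamSeq n + 1 : ℕ) : ℝ)) / 2
            = (Real.pi * t / 2 - Real.pi / 2) - (j : ℝ) * Real.pi
              - ((d * gamSeq n : ℤ) : ℝ) * (2 * Real.pi) := by
          rw [hj]; push_cast; ring
        rw [this, Real.cos_sub_int_mul_two_pi, Real.cos_sub_nat_mul_pi, mul_pow,
          Real.cos_sub_pi_div_two, ← pow_mul, mul_comm j 2, pow_mul]
        simp
      · congr 3; push_cast; ring

/-- The orthonormal basis `{e_{dγ} : γ ∈ Γ}`, for `d = 1` and `d = 5`. -/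
def expBasis (d : ℕ) (hd : d = 1 ∨ d = 5) : HilbertBasis ℕ ℂ L2Quarter :=
  HilbertBasis.mkOfOrthogonalEqBot
    (orthonormal_expL2_gamSeq (d := d) (by rcases hd with rfl | rfl <;> decide))
    (by
      refine (Submodule.eq_bot_iff _).2 fun f hf => ?_
      refine eq_zero_of_forall_inner_expL2_gamSeq hd f fun n => ?_
      exact hf _ (Submodule.subset_span ⟨n, rfl⟩))

theorem expBasis_apply {d : ℕ} (hd : d = 1 ∨ d = 5) (n : ℕ) :
    expBasis d hd n = expL2 (d * gamSeq n) := by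
  simp [expBasis]

/-- The coordinates of the basis `d = 1` are read in the basis `d = 5`; a continuous linear map is
determined by its values on a Hilbert basis. -/
theorem existsUnique_scalesByFive : ∃! U : L2Quarter ≃ₗᵢ[ℂ] L2Quarter, ScalesByFive U := by
  let b := expBasis 1 (Or.inl rfl)
  let c := expBasis 5 (Or.inr rfl)
  have hb : ∀ n, b n = expL2 (gamSeq n) := fun n => by simp [b, expBasis_apply]
  have hc : ∀ n, c n = expL2 (5 * gamSeq n) := fun n => by simp [c, expBasis_apply]
  refine ⟨b.repr.trans c.repr.symm, ?_, fun V hV => ?_⟩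
  · rintro g hg
    rw [← range_gamSeq] at hg
    obtain ⟨n, rfl⟩ := hg
    rw [← hb, ← hc, LinearIsometryEquiv.trans_apply, b.repr_self, c.repr_symm_single]
  · have hV' : ∀ n, V (b n) = c n := fun n => by
      rw [hb, hc]
      exact hV _ (range_gamSeq ▸ ⟨n, rfl⟩)
    ext1 x
    refine ((b.hasSum_repr x).mapL (V : L2Quarter →L[ℂ] L2Quarter)).unique ?_
    have := c.hasSum_repr_symm (b.repr x)
    simpa [hV'] using this

/-! ### Spectral integrals as an isometry on `L²(m_x)` -/

variable {S : Type*} [MeasurableSpace S]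
variable {H : Type*} [NormedAddCommGroup H] [InnerProductSpace ℂ H] [CompleteSpace H]

namespace ProjValuedMeasure

variable (E : ProjValuedMeasure S H)

theorem ext_proj {E F : ProjValuedMeasure S H} (h : ∀ A, MeasurableSet A → E.proj A = F.proj A) :
    E = F := by
  have : E.proj = F.proj := by
    funext A
    by_cases hA : MeasurableSet A
    · exact h A hA
    · rw [E.not_measurable A hA, F.not_measurable A hA]
  cases E; cases F; cases this; rfl

theorem proj_self_apply {A : Set S} (hA : MeasurableSet A) (x : H) :
    E.proj A (E.proj A x) = E.proj A x := by
  simpa using congrArg (fun T : H →L[ℂ] H => T x) (E.isStarProjection A hA).isIdempotentElem.eq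

theorem proj_apply_of_disjoint {A B : Set S} (hA : MeasurableSet A) (hB : MeasurableSet B)
    (h : Disjoint A B) (x : H) : E.proj A (E.proj B x) = 0 := by
  simpa using congrArg (fun T : H →L[ℂ] H => T x) (E.proj_mul_of_disjoint A B hA hB h)

/-- Used with `p` a pair of simple functions, to write operations on them over one common partition.
-/
theorem simpleIntegral_map (p : SimpleFunc S (ℂ × ℂ)) {g : ℂ × ℂ → ℂ} (hg : g 0 = 0) (x : H) :
    E.simpleIntegral (p.map g) x = ∑ a ∈ p.range, g a • E.proj (p ⁻¹' {a}) x := by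
  let T : Set S → ℂ →L[ℝ] H := fun A =>
    ((ContinuousLinearMap.toSpanSingleton ℂ (E.proj A x)) : ℂ →L[ℂ] H).restrictScalars ℝ
  -- The zero measure makes the finiteness conditions of `FinMeasAdditive` trivial.
  have hT : FinMeasAdditive (0 : Measure S) T := by
    intro A B hA hB _ _ hd
    ext c
    simp [T, E.proj_union hA hB hd]
  have key : ∀ u : SimpleFunc S ℂ, E.simpleIntegral u x = SimpleFunc.setToSimpleFunc T u := by
    intro u
    simp [simpleIntegral, SimpleFunc.setToSimpleFunc, T]
  rw [key, SimpleFunc.map_setToSimpleFunc T hT (by simp) hg]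
  simp [T]

theorem simpleIntegral_mul (s t : SimpleFunc S ℂ) (x : H) :
    E.simpleIntegral (s * t) x = E.simpleIntegral s (E.simpleIntegral t x) := by
  let p := s.pair t
  have h1 : s = p.map Prod.fst := by ext; rfl
  have h2 : t = p.map Prod.snd := by ext; rfl
  have h3 : s * t = p.map (fun a => a.1 * a.2) := by ext; rfl
  rw [h3, E.simpleIntegral_map p (by simp)]
  conv_rhs => rw [h1, h2, E.simpleIntegral_map p (by simp), E.simpleIntegral_map p (by simp)]
  refine Finset.sum_congr rfl fun a ha => ?_
  rw [map_sum, Finset.sum_eq_single_of_mem a ha]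
  · rw [map_smul, E.proj_self_apply (p.measurableSet_fiber a), smul_smul]
  · intro b _ hb
    rw [map_smul, E.proj_apply_of_disjoint (p.measurableSet_fiber a) (p.measurableSet_fiber b)
      (Disjoint.preimage p (Set.disjoint_singleton.2 hb.symm)), smul_zero]

theorem simpleIntegral_add (s t : SimpleFunc S ℂ) (x : H) :
    E.simpleIntegral (s + t) x = E.simpleIntegral s x + E.simpleIntegral t x := by
  have h := E.simpleIntegral_sub (s + t) t x
  rw [add_sub_cancel_right] at h
  rw [h, sub_add_cancel]

theorem simpleIntegral_const_smul (c : ℂ) (s : SimpleFunc S ℂ) (x : H) :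
    E.simpleIntegral (c • s) x = c • E.simpleIntegral s x := by
  let p := s.pair s
  have h1 : s = p.map Prod.fst := by ext; rfl
  have h3 : c • s = p.map (fun a => c • a.1) := by ext; rfl
  rw [h3, E.simpleIntegral_map p (by simp)]
  conv_rhs => rw [h1, E.simpleIntegral_map p (by simp), Finset.smul_sum]
  simp [smul_smul]

/-! ### Rules for spectral integrals of unbounded functions -/

variable {E}

/-- `IsIntegralAt` quantifies over all approximating sequences; since the integral exists, a single
one identifies it. -/
theorem isIntegralAt_of_tendsto {f : S → ℂ} (hf : Measurable f) {x w : H}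
    (hx : MemLp f 2 (E.scalarMeasure x)) {s : ℕ → SimpleFunc S ℂ}
    (hs : Tendsto (fun n => eLpNorm (⇑(s n) - f) 2 (E.scalarMeasure x)) atTop (𝓝 0))
    (hw : Tendsto (fun n => E.simpleIntegral (s n) x) atTop (𝓝 w)) : E.IsIntegralAt f x w := by
  obtain ⟨w', hw'⟩ := E.exists_isIntegralAt hf hx
  rwa [tendsto_nhds_unique hw (hw' s hs)]

theorem IsIntegralAt.unique {f : S → ℂ} (hf : Measurable f) {x w w' : H}
    (hx : MemLp f 2 (E.scalarMeasure x)) (h : E.IsIntegralAt f x w) (h' : E.IsIntegralAt f x w') :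
    w = w' := by
  obtain ⟨s, hs⟩ := exists_simpleFunc_tendsto hf
  exact tendsto_nhds_unique (h s (hs _ hx)) (h' s (hs _ hx))

theorem IsIntegralAt.congr_ae {f g : S → ℂ} {x w : H} (h : E.IsIntegralAt f x w)
    (hfg : f =ᵐ[E.scalarMeasure x] g) : E.IsIntegralAt g x w := by
  intro s hs
  refine h s (hs.congr fun n => eLpNorm_congr_ae ?_)
  filter_upwards [hfg] with z hz
  simp [hz]

theorem IsIntegralAt.add {f g : S → ℂ} (hf : Measurable f) (hg : Measurable g) {x w w' : H}
    (hx : MemLp f 2 (E.scalarMeasure x)) (hx' : MemLp g 2 (E.scalarMeasure x))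
    (h : E.IsIntegralAt f x w) (h' : E.IsIntegralAt g x w') :
    E.IsIntegralAt (f + g) x (w + w') := by
  obtain ⟨s, hs⟩ := exists_simpleFunc_tendsto hf
  obtain ⟨t, ht⟩ := exists_simpleFunc_tendsto hg
  refine isIntegralAt_of_tendsto (s := fun n => s n + t n) (hf.add hg) (hx.add hx') ?_ ?_
  · have := (hs _ hx).add (ht _ hx')
    rw [add_zero] at this
    refine tendsto_of_tendsto_of_tendsto_of_le_of_le tendsto_const_nhds this
      (fun _ => zero_le) fun n => ?_
    have e : (⇑(s n + t n) - (f + g) : S → ℂ) = (⇑(s n) - f) + (⇑(t n) - g) := by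
      rw [SimpleFunc.coe_add]; abel
    simp only [e]
    exact eLpNorm_add_le ((s n).measurable.sub hf).aestronglyMeasurable
      ((t n).measurable.sub hg).aestronglyMeasurable (by norm_num)
  · simp only [simpleIntegral_add]
    exact (h s (hs _ hx)).add (h' t (ht _ hx'))

theorem IsIntegralAt.const_smul {f : S → ℂ} (hf : Measurable f) {x w : H}
    (hx : MemLp f 2 (E.scalarMeasure x)) (c : ℂ) (h : E.IsIntegralAt f x w) :
    E.IsIntegralAt (c • f) x (c • w) := by
  obtain ⟨s, hs⟩ := exists_simpleFunc_tendsto hf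
  refine isIntegralAt_of_tendsto (s := fun n => c • s n) (hf.const_smul c) (hx.const_smul c) ?_ ?_
  · have := ENNReal.Tendsto.const_mul (a := ‖c‖ₑ) (hs _ hx) (Or.inr (by simp))
    rw [mul_zero] at this
    refine this.congr fun n => ?_
    rw [← eLpNorm_const_smul, smul_sub]
    rfl
  · simp only [simpleIntegral_const_smul]
    exact (h s (hs _ hx)).const_smul c

theorem IsIntegralAt.enorm_eq {f : S → ℂ} (hf : Measurable f) {x w : H}
    (hx : MemLp f 2 (E.scalarMeasure x)) (h : E.IsIntegralAt f x w) :
    ‖w‖ₑ = eLpNorm f 2 (E.scalarMeasure x) := by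
  obtain ⟨s, hs⟩ := exists_simpleFunc_tendsto hf
  have hs := hs _ hx
  have h1 := (continuous_enorm.tendsto w).comp (h s hs)
  have hmem : ∀ n, MemLp (s n) 2 (E.scalarMeasure x) := fun n =>
    SimpleFunc.memLp_of_isFiniteMeasure _ _ _
  have h2 := (Lp.tendsto_Lp_iff_tendsto_eLpNorm'' _ hmem _ hx).2 hs
  have h3 := (continuous_enorm.tendsto _).comp h2
  rw [Lp.enorm_toLp] at h3
  refine tendsto_nhds_unique (h1.congr fun n => ?_) h3
  simp only [Function.comp, Lp.enorm_toLp]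
  rw [E.enorm_simpleIntegral]

variable (E)

/-- The isometry `f ↦ (∫ f dE) x` from `L²(m_x)` to `H`. -/
def integralIsometry (x : H) : Lp ℂ 2 (E.scalarMeasure x) →ₗᵢ[ℂ] H where
  toFun f := E.integral f (Lp.stronglyMeasurable f).measurable ⟨x, Lp.memLp f⟩
  map_add' f g := by
    have hm : ∀ f : Lp ℂ 2 (E.scalarMeasure x), Measurable f := fun f =>
      (Lp.stronglyMeasurable f).measurable
    have hi : ∀ f : Lp ℂ 2 (E.scalarMeasure x), E.IsIntegralAt f x
      (E.integral f (hm f) ⟨x, Lp.memLp f⟩) := fun f => E.isIntegralAt_integral ⟨x, Lp.memLp f⟩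
    refine ((hi (f + g)).congr_ae (Lp.coeFn_add f g)).unique ((hm f).add (hm g))
      ((Lp.memLp f).add (Lp.memLp g)) ?_
    exact (hi f).add (hm f) (hm g) (Lp.memLp f) (Lp.memLp g) (hi g)
  map_smul' c f := by
    have hm : ∀ f : Lp ℂ 2 (E.scalarMeasure x), Measurable f := fun f =>
      (Lp.stronglyMeasurable f).measurable
    have hi : ∀ f : Lp ℂ 2 (E.scalarMeasure x), E.IsIntegralAt f x
      (E.integral f (hm f) ⟨x, Lp.memLp f⟩) := fun f => E.isIntegralAt_integral ⟨x, Lp.memLp f⟩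
    refine ((hi (c • f)).congr_ae (Lp.coeFn_smul c f)).unique ((hm f).const_smul c)
      ((Lp.memLp f).const_smul c) ?_
    exact (hi f).const_smul (hm f) (Lp.memLp f) c
  norm_map' f := by
    have h := (E.isIntegralAt_integral (hf := (Lp.stronglyMeasurable f).measurable)
      ⟨x, Lp.memLp f⟩).enorm_eq (Lp.stronglyMeasurable f).measurable (Lp.memLp f)
    rw [Lp.norm_def, ← h]
    exact (toReal_enorm _).symm

theorem isIntegralAt_integralIsometry {x : H} {f : S → ℂ} (hf : MemLp f 2 (E.scalarMeasure x)) :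
    E.IsIntegralAt f x (E.integralIsometry x (hf.toLp f)) :=
  (E.isIntegralAt_integral (hf := (Lp.stronglyMeasurable (hf.toLp f)).measurable)
    ⟨x, Lp.memLp (hf.toLp f)⟩).congr_ae hf.coeFn_toLp

theorem integralIsometry_toLp {x : H} {f : S → ℂ} (hf : Measurable f)
    (hx : MemLp f 2 (E.scalarMeasure x)) :
    E.integralIsometry x (hx.toLp f) = E.integral f hf ⟨x, E.mem_domain_integral.2 hx⟩ :=
  (E.isIntegralAt_integralIsometry hx).unique hf hx
    (E.isIntegralAt_integral ⟨x, E.mem_domain_integral.2 hx⟩)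

theorem integralIsometry_simpleFunc (x : H) (s : SimpleFunc S ℂ)
    (hs : MemLp s 2 (E.scalarMeasure x)) :
    E.integralIsometry x (hs.toLp s) = E.simpleIntegral s x := by
  refine tendsto_nhds_unique
    (E.isIntegralAt_integralIsometry hs (fun _ => s) (by simp)) tendsto_const_nhds

end ProjValuedMeasure

/-! ### The spectral measure of a unitary operator and cyclic subspaces -/

theorem memLp_circle_coe_mul {m : Measure Circle} {f : Circle → ℂ} (hf : MemLp f 2 m) :
    MemLp (fun z : Circle => (z : ℂ) * f z) 2 m :=
  hf.of_le (measurable_circle_coe.aestronglyMeasurable.mul hf.aestronglyMeasurable)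
    (ae_of_all _ fun z => by
      rw [norm_mul, Circle.norm_coe, one_mul])

theorem eLpNorm_circle_coe_mul {m : Measure Circle} (f : Circle → ℂ) :
    eLpNorm (fun z : Circle => (z : ℂ) * f z) 2 m = eLpNorm f 2 m :=
  eLpNorm_congr_norm_ae (ae_of_all _ fun z => by rw [norm_mul, Circle.norm_coe, one_mul])

theorem memLp_circle_coe (m : Measure Circle) [IsFiniteMeasure m] :
    MemLp (fun z : Circle => (z : ℂ)) 2 m :=
  MemLp.of_bound measurable_circle_coe.aestronglyMeasurable 1 (ae_of_all _ fun z => (Circle.norm_coe z).le)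

namespace IsSpectralMeasure

variable {U : H ≃ₗᵢ[ℂ] H} {E : ProjValuedMeasure Circle H}

theorem isIntegralAt (hE : IsSpectralMeasure U E) (x : H) :
    E.IsIntegralAt (fun z : Circle => (z : ℂ)) x (U x) := by
  have hx : x ∈ (E.integral (fun z : Circle => (z : ℂ)) measurable_circle_coe).domain :=
    memLp_circle_coe _
  have h := E.isIntegralAt_integral ⟨x, hx⟩
  have hv : E.integral (fun z : Circle => (z : ℂ)) measurable_circle_coe ⟨x, hx⟩ = U x :=
    (LinearPMap.ext_iff.1 hE).2 (x := x) (hf := hx) (hg := trivial)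
  rwa [hv] at h

theorem isIntegralAt_mul_simpleFunc (hE : IsSpectralMeasure U E) (s : SimpleFunc Circle ℂ) (x : H) :
    E.IsIntegralAt (fun z : Circle => (z : ℂ) * s z) x (U (E.simpleIntegral s x)) := by
  -- The same sequence `t` must approximate `z` for two measures: that of `x`, where boundedness of
  -- `s` gives `t n * s → z s`, and that of `E.simpleIntegral s x`, where the integral of `z` is
  -- `U`.
  obtain ⟨t, ht⟩ := ProjValuedMeasure.exists_simpleFunc_tendsto measurable_circle_coe
  have hs : MemLp s 2 (E.scalarMeasure x) := SimpleFunc.memLp_of_isFiniteMeasure _ _ _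
  refine ProjValuedMeasure.isIntegralAt_of_tendsto (s := fun n => t n * s)
    (measurable_circle_coe.mul s.measurable) (memLp_circle_coe_mul hs) ?_ ?_
  · obtain ⟨C, hC⟩ := s.exists_forall_norm_le
    have h := ENNReal.Tendsto.const_mul (a := ENNReal.ofReal C)
      (ht _ (memLp_circle_coe (E.scalarMeasure x))) (Or.inr (by simp))
    rw [mul_zero] at h
    refine tendsto_of_tendsto_of_tendsto_of_le_of_le tendsto_const_nhds h
      (fun _ => zero_le) fun n => ?_
    refine eLpNorm_le_mul_eLpNorm_of_ae_le_mul (ae_of_all _ fun z => ?_) 2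
    simp only [SimpleFunc.coe_mul, Pi.sub_apply, Pi.mul_apply]
    rw [← sub_mul, norm_mul, mul_comm]
    gcongr
    exact hC z
  · simp only [E.simpleIntegral_mul]
    exact hE.isIntegralAt _ t (ht _ (memLp_circle_coe _))

/-- In the model `L²(m_x)`, `U` is multiplication by `z`. The simple case extends by density, as
multiplication by `z` preserves the `L²` norm. -/
theorem map_integralIsometry (hE : IsSpectralMeasure U E) {x : H} {f : Circle → ℂ}
    (hf : Measurable f) (hx : MemLp f 2 (E.scalarMeasure x)) :
    U (E.integralIsometry x (hx.toLp f))
      = E.integralIsometry x ((memLp_circle_coe_mul hx).toLp _) := by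
  obtain ⟨s, hs⟩ := ProjValuedMeasure.exists_simpleFunc_tendsto hf
  have hs := hs _ hx
  have hmem : ∀ n, MemLp (s n) 2 (E.scalarMeasure x) := fun n =>
    SimpleFunc.memLp_of_isFiniteMeasure _ _ _
  have h1 : Tendsto (fun n => U (E.simpleIntegral (s n) x)) atTop
      (𝓝 (U (E.integralIsometry x (hx.toLp f)))) :=
    (U.continuous.tendsto _).comp (E.isIntegralAt_integralIsometry hx s hs)
  have h2 : Tendsto (fun n => (memLp_circle_coe_mul (hmem n)).toLp _) atTop
      (𝓝 ((memLp_circle_coe_mul hx).toLp _)) := by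
    refine (Lp.tendsto_Lp_iff_tendsto_eLpNorm'' _ (fun n => memLp_circle_coe_mul (hmem n)) _
      (memLp_circle_coe_mul hx)).2 (hs.congr fun n => ?_)
    rw [← eLpNorm_circle_coe_mul]
    congr 1
    funext z
    simp [mul_sub]
  have h3 := ((E.integralIsometry x).continuous.tendsto _).comp h2
  refine tendsto_nhds_unique h1 (h3.congr fun n => ?_)
  exact (E.isIntegralAt_integralIsometry _).unique (measurable_circle_coe.mul (s n).measurable)
    (memLp_circle_coe_mul (hmem n)) (hE.isIntegralAt_mul_simpleFunc (s n) x)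

end IsSpectralMeasure

/-- The inclusion of the unit circle in `ℂ` as a continuous function. -/
def circleCoe : C(Circle, ℂ) := ⟨fun z => (z : ℂ), by fun_prop⟩

theorem circleCoe_mul_star : circleCoe * star circleCoe = 1 := by
  ext z
  change (z : ℂ) * (starRingEnd ℂ) (z : ℂ) = 1
  rw [Complex.mul_conj, Circle.normSq_coe, Complex.ofReal_one]

/-- Stone–Weierstrass on the circle, as an induction principle. -/
theorem circle_induction {P : C(Circle, ℂ) → Prop} (hc : IsClosed {f | P f}) (h1 : P circleCoe)
    (h2 : P (star circleCoe)) (h3 : ∀ c : ℂ, P (algebraMap ℂ _ c))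
    (hadd : ∀ f g, P f → P g → P (f + g)) (hmul : ∀ f g, P f → P g → P (f * g))
    (f : C(Circle, ℂ)) : P f := by
  let A : StarSubalgebra ℂ C(Circle, ℂ) := StarAlgebra.adjoin ℂ {circleCoe}
  have hA : A.topologicalClosure = ⊤ := by
    refine ContinuousMap.starSubalgebra_topologicalClosure_eq_top_of_separatesPoints A ?_
    intro z w hzw
    refine ⟨circleCoe, ⟨circleCoe, StarAlgebra.subset_adjoin ℂ _ rfl, rfl⟩, ?_⟩
    exact fun h => hzw (Circle.ext h)
  have hAP : ∀ g ∈ A, P g := by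
    intro g hg
    have hg' : g ∈ Algebra.adjoin ℂ ({circleCoe} ∪ star {circleCoe} : Set C(Circle, ℂ)) := by
      rw [← StarAlgebra.adjoin_toSubalgebra]; exact hg
    induction hg' using Algebra.adjoin_induction with
    | mem x hx =>
      rcases hx with hx | hx
      · rw [Set.mem_singleton_iff.1 hx]; exact h1
      · rw [Set.mem_star, Set.mem_singleton_iff] at hx
        rw [← star_star x, hx]; exact h2
    | algebraMap c => exact h3 c
    | add x y hx hy ihx ihy =>
      refine hadd x y (ihx ?_) (ihy ?_)
      · change x ∈ A.toSubalgebra; rw [StarAlgebra.adjoin_toSubalgebra]; exact hx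
      · change y ∈ A.toSubalgebra; rw [StarAlgebra.adjoin_toSubalgebra]; exact hy
    | mul x y hx hy ihx ihy =>
      refine hmul x y (ihx ?_) (ihy ?_)
      · change x ∈ A.toSubalgebra; rw [StarAlgebra.adjoin_toSubalgebra]; exact hx
      · change y ∈ A.toSubalgebra; rw [StarAlgebra.adjoin_toSubalgebra]; exact hy
  have hf : f ∈ closure (A : Set C(Circle, ℂ)) := by
    rw [← StarSubalgebra.topologicalClosure_coe, hA]; trivial
  exact closure_minimal hAP hc hf

namespace ProjValuedMeasure

/-- The map `f ↦ (∫ f dE) x` on continuous functions. -/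
def continuousIntegral (E : ProjValuedMeasure Circle H) (x : H) : C(Circle, ℂ) →L[ℂ] H :=
  (E.integralIsometry x).toContinuousLinearMap ∘L ContinuousMap.toLp 2 (E.scalarMeasure x) ℂ

theorem memLp_continuousMap (m : Measure Circle) [IsFiniteMeasure m] (f : C(Circle, ℂ)) :
    MemLp f 2 m :=
  MemLp.of_bound f.continuous.aestronglyMeasurable ‖f‖ (ae_of_all _ fun z => f.norm_coe_le_norm z)

theorem continuousIntegral_apply (E : ProjValuedMeasure Circle H) (x : H) (f : C(Circle, ℂ)) :
    E.continuousIntegral x f = E.integralIsometry x ((memLp_continuousMap _ f).toLp f) := rfl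

theorem enorm_continuousIntegral (E : ProjValuedMeasure Circle H) (x : H) (f : C(Circle, ℂ)) :
    ‖E.continuousIntegral x f‖ₑ = eLpNorm f 2 (E.scalarMeasure x) := by
  rw [continuousIntegral_apply, ← Lp.enorm_toLp (memLp_continuousMap _ f)]
  exact (E.integralIsometry x).enorm_map _

theorem continuousIntegral_one (E : ProjValuedMeasure Circle H) (x : H) :
    E.continuousIntegral x 1 = x := by
  let s : SimpleFunc Circle ℂ := SimpleFunc.const Circle 1
  have hx : E.simpleIntegral s x = x := by
    have : s ⁻¹' {1} = Set.univ := by ext; simp [s]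
    have hr : s.range = {1} := SimpleFunc.range_const Circle 1
    rw [simpleIntegral, hr, Finset.sum_singleton, this, E.proj_univ]
    simp
  conv_rhs => rw [← hx]
  exact E.integralIsometry_simpleFunc x s (SimpleFunc.memLp_of_isFiniteMeasure _ _ _)

end ProjValuedMeasure

namespace IsSpectralMeasure

variable {U : H ≃ₗᵢ[ℂ] H} {E : ProjValuedMeasure Circle H}

theorem map_continuousIntegral (hE : IsSpectralMeasure U E) (x : H) (f : C(Circle, ℂ)) :
    U (E.continuousIntegral x f) = E.continuousIntegral x (circleCoe * f) :=
  hE.map_integralIsometry f.continuous.measurable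
    (ProjValuedMeasure.memLp_continuousMap _ f)

theorem symm_continuousIntegral (hE : IsSpectralMeasure U E) (x : H) (f : C(Circle, ℂ)) :
    U.symm (E.continuousIntegral x f) = E.continuousIntegral x (star circleCoe * f) := by
  rw [LinearIsometryEquiv.symm_apply_eq, hE.map_continuousIntegral, ← mul_assoc,
    circleCoe_mul_star, one_mul]

theorem continuousIntegral_eq {F : ProjValuedMeasure Circle H} (hE : IsSpectralMeasure U E)
    (hF : IsSpectralMeasure U F) (x : H) (f : C(Circle, ℂ)) :
    E.continuousIntegral x f = F.continuousIntegral x f := by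
  -- Multiplication by `f` preserving agreement is a property stable under products of `f`, unlike
  -- bare agreement at `f`. Taking `g = 1` at the end recovers the claim.
  have key : ∀ g, E.continuousIntegral x g = F.continuousIntegral x g →
      E.continuousIntegral x (f * g) = F.continuousIntegral x (f * g) := by
    induction f using circle_induction with
    | hc =>
      simp only [Set.ofPred_forall]
      refine isClosed_iInter fun g => isClosed_iInter fun _ => isClosed_eq ?_ ?_ <;> fun_prop
    | h1 =>
      intro g hg
      rw [← hE.map_continuousIntegral, ← hF.map_continuousIntegral, hg]
    | h2 =>
      intro g hg
      rw [← hE.symm_continuousIntegral, ← hF.symm_continuousIntegral, hg]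
    | h3 c =>
      intro g hg
      rw [← Algebra.smul_def, map_smul, map_smul, hg]
    | hadd f g h h' =>
      intro k hk
      rw [add_mul, map_add, map_add, h k hk, h' k hk]
    | hmul f g h h' =>
      intro k hk
      rw [mul_assoc]
      exact h _ (h' k hk)
  have := key 1 (by rw [E.continuousIntegral_one, F.continuousIntegral_one])
  rwa [mul_one] at this

theorem scalarMeasure_eq {F : ProjValuedMeasure Circle H} (hE : IsSpectralMeasure U E)
    (hF : IsSpectralMeasure U F) (x : H) : E.scalarMeasure x = F.scalarMeasure x := by
  refine ext_of_forall_lintegral_eq_of_IsFiniteMeasure fun f => ?_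
  -- As `f = |g|²`, its integral is the squared norm of the spectral integral of `g` at `x`, which
  -- is the same for `E` and `F`.
  let g : C(Circle, ℂ) := ⟨fun z => (Real.sqrt (f z) : ℂ), by fun_prop⟩
  have hg : ∀ m : Measure Circle, ∫⁻ z, (f z : ℝ≥0∞) ∂m = eLpNorm g 2 m ^ 2 := by
    intro m
    rw [eLpNorm_eq_lintegral_rpow_enorm_toReal (by norm_num) (by norm_num)]
    simp only [ENNReal.toReal_ofNat, ENNReal.rpow_ofNat]
    rw [one_div, ← ENNReal.rpow_ofNat, ← ENNReal.rpow_mul]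
    norm_num
    refine lintegral_congr fun z => ?_
    have : ‖g z‖ₑ = ENNReal.ofReal (Real.sqrt (f z)) := by
      rw [← ofReal_norm]
      simp [g, Complex.norm_real, abs_of_nonneg (Real.sqrt_nonneg _)]
    rw [this, ← ENNReal.ofReal_pow (Real.sqrt_nonneg _), Real.sq_sqrt (f z).coe_nonneg]
    simp
  rw [hg, hg, ← E.enorm_continuousIntegral, ← F.enorm_continuousIntegral,
    hE.continuousIntegral_eq hF]

theorem unique {F : ProjValuedMeasure Circle H} (hE : IsSpectralMeasure U E)
    (hF : IsSpectralMeasure U F) : E = F := by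
  refine ProjValuedMeasure.ext_proj fun A hA => ?_
  have h : ∀ x, inner ℂ (E.proj A x) x = inner ℂ (F.proj A x) x := by
    intro x
    have := congrArg (fun m : Measure Circle => m A) (hE.scalarMeasure_eq hF x)
    simp only [ProjValuedMeasure.scalarMeasure_apply' _ hA] at this
    rw [E.inner_proj_self, F.inner_proj_self]
    have h2 : ‖E.proj A x‖ = ‖F.proj A x‖ := by
      have := (ENNReal.pow_right_strictMono two_ne_zero).injective this
      rw [← toReal_enorm, this, toReal_enorm]
    rw [h2]
  have := (ext_inner_map (E.proj A : H →ₗ[ℂ] H) (F.proj A : H →ₗ[ℂ] H)).1 h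
  exact ContinuousLinearMap.coe_injective this

/-! ### Cyclic subspaces as ranges of the spectral isometry -/

theorem adjoint_apply (U : H ≃ₗᵢ[ℂ] H) (x : H) :
    ContinuousLinearMap.adjoint (U : H →L[ℂ] H) x = U.symm x := by
  refine ext_inner_right ℂ fun y => ?_
  rw [ContinuousLinearMap.adjoint_inner_left]
  have := U.inner_map_map (U.symm x) y
  simpa using this

theorem cyclicSubspace_eq_range (hE : IsSpectralMeasure U E) (v : H) :
    cyclicSubspace U v = LinearMap.range (E.integralIsometry v).toLinearMap := by
  have hdense : DenseRange (ContinuousMap.toLp (E := ℂ) 2 (E.scalarMeasure v) ℂ) :=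
    ContinuousMap.toLp_denseRange ℂ (E.scalarMeasure v) ℂ (by norm_num)
  have hclosed : IsClosed (Set.range (E.integralIsometry v)) :=
    (E.integralIsometry v).isometry.isClosedEmbedding.isClosed_range
  -- The range is closed, so its invariance need only be checked on the images of continuous
  -- functions.
  have hmap : ∀ T : H →L[ℂ] H, ∀ e : C(Circle, ℂ),
      (∀ f, T (E.continuousIntegral v f) = E.continuousIntegral v (e * f)) →
      ∀ g, T (E.integralIsometry v g) ∈ Set.range (E.integralIsometry v) := by
    intro T e hT g
    refine hdense.induction_on (p := fun g => T (E.integralIsometry v g) ∈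
      Set.range (E.integralIsometry v)) g (hclosed.preimage (by fun_prop)) fun f => ?_
    exact ⟨_, (hT f).symm⟩
  apply le_antisymm
  · refine sInf_le ⟨hclosed, ?_, ?_, ?_⟩
    · exact ⟨_, E.continuousIntegral_one v⟩
    · rintro _ ⟨g, rfl⟩
      exact hmap (U : H →L[ℂ] H) _ (hE.map_continuousIntegral v) g
    · rintro _ ⟨g, rfl⟩
      rw [adjoint_apply]
      exact hmap (U.symm : H →L[ℂ] H) _ (hE.symm_continuousIntegral v) g
  · refine le_sInf ?_
    rintro K ⟨hK, hv, hU, hU'⟩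
    -- Quantifying over `g` makes the property of `f` multiplicative, as Stone–Weierstrass induction
    -- requires.
    have key : ∀ f g, E.continuousIntegral v g ∈ K → E.continuousIntegral v (f * g) ∈ K := by
      intro f
      induction f using circle_induction with
      | hc =>
        simp only [Set.ofPred_forall]
        refine isClosed_iInter fun g => isClosed_iInter fun _ => hK.preimage ?_
        fun_prop
      | h1 =>
        intro g hg
        rw [← hE.map_continuousIntegral]
        exact hU _ hg
      | h2 =>
        intro g hg
        rw [← hE.symm_continuousIntegral, ← adjoint_apply]
        exact hU' _ hg
      | h3 c =>
        intro g hg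
        rw [← Algebra.smul_def, map_smul]
        exact K.smul_mem c hg
      | hadd f g h h' =>
        intro k hk
        rw [add_mul, map_add]
        exact K.add_mem (h k hk) (h' k hk)
      | hmul f g h h' =>
        intro k hk
        rw [mul_assoc]
        exact h _ (h' k hk)
    rintro _ ⟨g, rfl⟩
    refine hdense.induction_on (p := fun g => E.integralIsometry v g ∈ K) g
      (hK.preimage (E.integralIsometry v).continuous) fun f => ?_
    have := key f 1 (by rwa [E.continuousIntegral_one])
    rwa [mul_one] at this

theorem cyclicSubspace_eq (hE : IsSpectralMeasure U E) (v : H) :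
    (cyclicSubspace U v : Set H) =
      {w | ∃ (f : Circle → ℂ) (hf : Measurable f) (hv : MemLp f 2 (E.scalarMeasure v)),
        E.integral f hf ⟨v, E.mem_domain_integral.2 hv⟩ = w} := by
  rw [hE.cyclicSubspace_eq_range]
  ext w
  constructor
  · rintro ⟨g, rfl⟩
    exact ⟨g, (Lp.stronglyMeasurable g).measurable, Lp.memLp g, rfl⟩
  · rintro ⟨f, hf, hv, rfl⟩
    exact ⟨hv.toLp f, E.integralIsometry_toLp hf hv⟩

theorem exists_isometryEquiv (hE : IsSpectralMeasure U E) (v : H) :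
    ∃ R : Lp ℂ 2 (E.scalarMeasure v) ≃ₗᵢ[ℂ] cyclicSubspace U v,
      ∀ (f : Circle → ℂ) (hf : Measurable f) (hv : MemLp f 2 (E.scalarMeasure v)),
        (R (hv.toLp f) : H) = E.integral f hf ⟨v, E.mem_domain_integral.2 hv⟩ := by
  rw [hE.cyclicSubspace_eq_range]
  exact ⟨(E.integralIsometry v).equivRange, fun f hf hv => E.integralIsometry_toLp hf hv⟩

end IsSpectralMeasure

/-! ### From a continuous functional calculus on the circle to a projection-valued measure -/

/-- A real continuous function on the circle as a complex one. -/
def realToComplex (f : C(Circle, ℝ)) : C(Circle, ℂ) := ⟨fun z => (f z : ℂ), by fun_prop⟩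

theorem star_realToComplex (f : C(Circle, ℝ)) : star (realToComplex f) = realToComplex f := by
  ext z
  exact Complex.conj_ofReal _

theorem tendsto_eLpNorm_of_le {α : Type*} [MeasurableSpace α] {m m' : Measure α} (h : m' ≤ m)
    {f : ℕ → α → ℂ} (hf : Tendsto (fun n => eLpNorm (f n) 2 m) atTop (𝓝 0)) :
    Tendsto (fun n => eLpNorm (f n) 2 m') atTop (𝓝 0) :=
  tendsto_of_tendsto_of_tendsto_of_le_of_le tendsto_const_nhds hf (fun _ => zero_le)
    fun _ => eLpNorm_mono_measure _ h

/-- Clamping an `L²` approximation to `[0, 1]` does not increase its distance to an indicator. The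
bound serves to control products, real values to make the operators `Φ (f n)` self-adjoint. -/
theorem exists_continuous_tendsto_indicator (m : Measure Circle) [IsFiniteMeasure m]
    {A : Set Circle} (hA : MeasurableSet A) :
    ∃ f : ℕ → C(Circle, ℝ), (∀ n z, |f n z| ≤ 1) ∧
      Tendsto (fun n => eLpNorm (⇑(realToComplex (f n)) - A.indicator fun _ => (1 : ℂ)) 2 m)
        atTop (𝓝 0) := by
  have hmem : MemLp (A.indicator fun _ => (1 : ℝ)) 2 m :=
    (memLp_const (1 : ℝ)).indicator hA
  choose g hg _ using fun n : ℕ => hmem.exists_boundedContinuous_eLpNorm_sub_le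
    (by norm_num : (2 : ℝ≥0∞) ≠ ∞) (ε := ((n : ℝ≥0∞) + 1)⁻¹) (by simp)
  refine ⟨fun n => ⟨fun z => max 0 (min 1 (g n z)), by fun_prop⟩, fun n z => ?_, ?_⟩
  · change |max 0 (min 1 (g n z))| ≤ 1
    rw [abs_of_nonneg (le_max_left _ _)]
    exact max_le zero_le_one (min_le_left _ _)
  · have hlim : Tendsto (fun n : ℕ => ((n : ℝ≥0∞) + 1)⁻¹) atTop (𝓝 0) := by
      have := (tendsto_add_atTop_iff_nat 1).2 ENNReal.tendsto_inv_nat_nhds_zero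
      simpa using this
    refine tendsto_of_tendsto_of_tendsto_of_le_of_le tendsto_const_nhds hlim
      (fun _ => zero_le) fun n => (eLpNorm_mono_ae (ae_of_all _ fun z => ?_)).trans (hg n)
    change ‖((max 0 (min 1 (g n z)) : ℝ) : ℂ) - A.indicator (fun _ => (1 : ℂ)) z‖
      ≤ ‖A.indicator (fun _ => (1 : ℝ)) z - g n z‖
    have e : A.indicator (fun _ => (1 : ℂ)) z = ((A.indicator (fun _ => (1 : ℝ)) z : ℝ) : ℂ) := by
      by_cases hz : z ∈ A <;> simp [hz]
    rw [e, ← Complex.ofReal_sub, Complex.norm_real, Real.norm_eq_abs, Real.norm_eq_abs,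
      abs_sub_comm]
    by_cases hz : z ∈ A
    · simp only [Set.indicator_of_mem hz]
      grind
    · simp only [Set.indicator_of_notMem hz]
      grind

section Calculus

variable (Φ : C(Circle, ℂ) →⋆ₐ[ℂ] (H →L[ℂ] H))

theorem inner_starHom_apply (f g : C(Circle, ℂ)) (x y : H) :
    inner ℂ (Φ f x) (Φ g y) = inner ℂ x (Φ (star f * g) y) := by
  rw [map_mul, map_star, ContinuousLinearMap.star_eq_adjoint]
  exact (ContinuousLinearMap.adjoint_inner_right _ _ _).symm

theorem norm_starHom_apply_sq (f : C(Circle, ℂ)) (x : H) :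
    ‖Φ f x‖ ^ 2 = (inner ℂ x (Φ (star f * f) x)).re := by
  rw [← inner_starHom_apply, ← @inner_self_eq_norm_sq ℂ]
  rfl

/-- Riesz–Markov for `f ↦ Re ⟨x, Φ(f) x⟩`, which is positive: for `f ≥ 0` and `g = √f` its value is
`‖Φ(g) x‖²`. Applied to `|f|²`, the representation gives the norm formula. -/
theorem exists_measure_enorm_starHom (x : H) :
    ∃ m : Measure Circle, IsFiniteMeasure m ∧ ∀ f, ‖Φ f x‖ₑ = eLpNorm f 2 m := by
  let L : CompactlySupportedContinuousMap Circle ℝ →ₗ[ℝ] ℝ :=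
    { toFun := fun f => (inner ℂ x (Φ (realToComplex f) x)).re
      map_add' := fun f g => by
        have : realToComplex (f + g : CompactlySupportedContinuousMap Circle ℝ)
            = realToComplex f + realToComplex g := by
          ext z; simp [realToComplex]
        rw [this, map_add, add_apply, inner_add_right, Complex.add_re]
      map_smul' := fun c f => by
        have : realToComplex (c • f : CompactlySupportedContinuousMap Circle ℝ)
            = (c : ℂ) • realToComplex f := by
          ext z; simp [realToComplex]
        rw [this, map_smul, smul_apply, inner_smul_right, Complex.re_ofReal_mul]
        rfl }
  have hL : ∀ f, 0 ≤ f → 0 ≤ L f := by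
    intro f hf
    let g : C(Circle, ℂ) := realToComplex ⟨fun z => Real.sqrt (f z), by fun_prop⟩
    have : realToComplex (f : C(Circle, ℝ)) = star g * g := by
      rw [star_realToComplex]
      ext z
      change ((f z : ℝ) : ℂ) = (Real.sqrt (f z) : ℂ) * (Real.sqrt (f z) : ℂ)
      rw [← Complex.ofReal_mul, Real.mul_self_sqrt (hf z)]
    change 0 ≤ (inner ℂ x (Φ (realToComplex f) x)).re
    rw [this, ← norm_starHom_apply_sq]
    positivity
  let P := PositiveLinearMap.mk₀ L hL
  refine ⟨RealRMK.rieszMeasure P, inferInstance, fun f => ?_⟩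
  let k : CompactlySupportedContinuousMap Circle ℝ :=
    { toFun := fun z => ‖f z‖ ^ 2
      continuous_toFun := by fun_prop
      hasCompactSupport' := HasCompactSupport.of_compactSpace _ }
  have hk : ∫ z, ‖f z‖ ^ 2 ∂(RealRMK.rieszMeasure P) = ‖Φ f x‖ ^ 2 := by
    refine (RealRMK.integral_rieszMeasure P k).trans ?_
    change (inner ℂ x (Φ (realToComplex k) x)).re = _
    rw [norm_starHom_apply_sq]
    congr 4
    ext z
    change ((‖f z‖ ^ 2 : ℝ) : ℂ) = (starRingEnd ℂ) (f z) * f z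
    rw [Complex.conj_mul']
    push_cast
    rfl
  rw [MemLp.eLpNorm_eq_integral_rpow_norm (by norm_num) (by norm_num)
    (ProjValuedMeasure.memLp_continuousMap _ f)]
  simp only [ENNReal.toReal_ofNat, Real.rpow_ofNat]
  rw [hk, ← Real.rpow_ofNat, ← Real.rpow_mul (norm_nonneg _)]
  norm_num

/-- The measure `m_x` with `‖Φ(f) x‖² = ∫ |f|² dm_x`. -/
def calculusMeasure (x : H) : Measure Circle := (exists_measure_enorm_starHom Φ x).choose

instance instIsFiniteMeasureCalculusMeasure (x : H) : IsFiniteMeasure (calculusMeasure Φ x) :=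
  (exists_measure_enorm_starHom Φ x).choose_spec.1

theorem enorm_starHom (x : H) (f : C(Circle, ℂ)) :
    ‖Φ f x‖ₑ = eLpNorm f 2 (calculusMeasure Φ x) :=
  (exists_measure_enorm_starHom Φ x).choose_spec.2 f

theorem norm_starHom (x : H) (f : C(Circle, ℂ)) :
    ‖Φ f x‖ = ‖ContinuousMap.toLp (E := ℂ) 2 (calculusMeasure Φ x) ℂ f‖ := by
  have h : ContinuousMap.toLp (E := ℂ) 2 (calculusMeasure Φ x) ℂ f
    = (ProjValuedMeasure.memLp_continuousMap _ f).toLp f := rfl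
  rw [← toReal_enorm, enorm_starHom, h, Lp.norm_toLp]

/-- The extension of `f ↦ Φ(f) x` to `L²(m_x)`. -/
def calculusExt (x : H) : Lp ℂ 2 (calculusMeasure Φ x) →L[ℂ] H :=
  LinearMap.extendOfNorm
    { toFun := fun f => Φ f x
      map_add' := fun f g => by simp
      map_smul' := fun c f => by simp }
    (ContinuousMap.toLp (E := ℂ) 2 (calculusMeasure Φ x) ℂ).toLinearMap

theorem denseRange_toLp (x : H) :
    DenseRange (ContinuousMap.toLp (E := ℂ) 2 (calculusMeasure Φ x) ℂ) :=
  ContinuousMap.toLp_denseRange ℂ _ ℂ (by norm_num)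

theorem calculusExt_toLp (x : H) {f : C(Circle, ℂ)} (hf : MemLp f 2 (calculusMeasure Φ x)) :
    calculusExt Φ x (hf.toLp f) = Φ f x :=
  LinearMap.extendOfNorm_eq (denseRange_toLp Φ x)
    ⟨1, fun f => by rw [one_mul]; exact (norm_starHom Φ x f).le⟩ f

theorem enorm_calculusExt (x : H) (u : Lp ℂ 2 (calculusMeasure Φ x)) :
    ‖calculusExt Φ x u‖ₑ = ‖u‖ₑ := by
  refine (denseRange_toLp Φ x).induction_on (p := fun u => ‖calculusExt Φ x u‖ₑ = ‖u‖ₑ) u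
    (isClosed_eq (by fun_prop) (by fun_prop)) fun f => ?_
  have h : ContinuousMap.toLp (E := ℂ) 2 (calculusMeasure Φ x) ℂ f
    = (ProjValuedMeasure.memLp_continuousMap _ f).toLp f := rfl
  rw [h, calculusExt_toLp, enorm_starHom, Lp.enorm_toLp]

/-- The value of the spectral projection of `A` at `x`. -/
def calculusProj {A : Set Circle} (hA : MeasurableSet A) (x : H) : H :=
  calculusExt Φ x (indicatorConstLp 2 hA (measure_ne_top _ _) 1)

theorem enorm_calculusProj {A : Set Circle} (hA : MeasurableSet A) (x : H) :
    ‖calculusProj Φ hA x‖ₑ ^ 2 = calculusMeasure Φ x A := by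
  rw [calculusProj, enorm_calculusExt, indicatorConstLp, Lp.enorm_toLp,
    eLpNorm_indicator_const hA (by norm_num) (by norm_num), enorm_one, one_mul,
    ← ENNReal.rpow_ofNat, ← ENNReal.rpow_mul]
  norm_num

/-! ### Algebra of the spectral projections -/

theorem memLp_indicator_one (m : Measure Circle) [IsFiniteMeasure m] {A : Set Circle}
    (hA : MeasurableSet A) : MemLp (A.indicator fun _ => (1 : ℂ)) 2 m :=
  (memLp_const (1 : ℂ)).indicator hA

theorem tendsto_calculusProj {A : Set Circle} (hA : MeasurableSet A) {x : H}
    {f : ℕ → C(Circle, ℂ)}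
    (hf : Tendsto (fun n => eLpNorm (⇑(f n) - A.indicator fun _ => (1 : ℂ)) 2
      (calculusMeasure Φ x)) atTop (𝓝 0)) :
    Tendsto (fun n => Φ (f n) x) atTop (𝓝 (calculusProj Φ hA x)) := by
  have h := (Lp.tendsto_Lp_iff_tendsto_eLpNorm'' _
    (fun n => ProjValuedMeasure.memLp_continuousMap _ (f n)) _ (memLp_indicator_one _ hA)).2 hf
  refine (((calculusExt Φ x).continuous.tendsto _).comp h).congr fun n => ?_
  exact calculusExt_toLp Φ x _

/-- Linearity is not automatic, since the construction uses a different space `L²(m_x)` for each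
vector. Approximating the indicator in the sum of the three measures gives one sequence valid for
all of them. -/
theorem calculusProj_add {A : Set Circle} (hA : MeasurableSet A) (x y : H) :
    calculusProj Φ hA (x + y) = calculusProj Φ hA x + calculusProj Φ hA y := by
  obtain ⟨f, -, hf⟩ := exists_continuous_tendsto_indicator
    (calculusMeasure Φ x + (calculusMeasure Φ y + calculusMeasure Φ (x + y))) hA
  have hx := tendsto_calculusProj Φ hA (tendsto_eLpNorm_of_le (Measure.le_add_right le_rfl) hf)
  have hy := tendsto_calculusProj Φ hA (tendsto_eLpNorm_of_le
    (Measure.le_add_left (Measure.le_add_right le_rfl)) hf)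
  have hxy := tendsto_calculusProj Φ hA (tendsto_eLpNorm_of_le
    (Measure.le_add_left (Measure.le_add_left le_rfl)) hf)
  exact tendsto_nhds_unique hxy ((hx.add hy).congr fun n => (map_add _ _ _).symm)

theorem calculusProj_smul {A : Set Circle} (hA : MeasurableSet A) (c : ℂ) (x : H) :
    calculusProj Φ hA (c • x) = c • calculusProj Φ hA x := by
  obtain ⟨f, -, hf⟩ := exists_continuous_tendsto_indicator
    (calculusMeasure Φ x + calculusMeasure Φ (c • x)) hA
  have hx := tendsto_calculusProj Φ hA (tendsto_eLpNorm_of_le (Measure.le_add_right le_rfl) hf)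
  have hcx := tendsto_calculusProj Φ hA (tendsto_eLpNorm_of_le (Measure.le_add_left le_rfl) hf)
  exact tendsto_nhds_unique hcx ((hx.const_smul c).congr fun n => (map_smul _ _ _).symm)

theorem calculusProj_univ (x : H) : calculusProj Φ MeasurableSet.univ x = x := by
  have h := tendsto_calculusProj Φ MeasurableSet.univ (x := x) (f := fun _ => 1) (by
    have : ((1 : C(Circle, ℂ)) : Circle → ℂ) - Set.univ.indicator (fun _ => (1 : ℂ)) = 0 := by
      ext z; simp
    rw [this]
    simp)
  simpa using (tendsto_nhds_unique h tendsto_const_nhds)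

theorem calculusProj_empty (x : H) : calculusProj Φ MeasurableSet.empty x = 0 := by
  simp [calculusProj]

theorem calculusProj_congr {A B : Set Circle} (h : A = B) (hA : MeasurableSet A)
    (hB : MeasurableSet B) (x : H) : calculusProj Φ hA x = calculusProj Φ hB x := by
  subst h; rfl

/-- Limit of `⟨Φ(f) x, Φ(g) y⟩ = ⟨x, Φ(f g) y⟩` for real `f → 1_A`, `g → 1_B`. It contains both
self-adjointness (`B` the whole circle) and multiplicativity of the projections. -/
theorem inner_calculusProj {A B : Set Circle} (hA : MeasurableSet A) (hB : MeasurableSet B)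
    (x y : H) : inner ℂ (calculusProj Φ hA x) (calculusProj Φ hB y)
      = inner ℂ x (calculusProj Φ (hA.inter hB) y) := by
  obtain ⟨f, hf1, hf⟩ := exists_continuous_tendsto_indicator
    (calculusMeasure Φ x + calculusMeasure Φ y) hA
  obtain ⟨g, -, hg⟩ := exists_continuous_tendsto_indicator (calculusMeasure Φ y) hB
  have hfx := tendsto_eLpNorm_of_le (m' := calculusMeasure Φ x) (Measure.le_add_right le_rfl) hf
  have hfy := tendsto_eLpNorm_of_le (m' := calculusMeasure Φ y) (Measure.le_add_left le_rfl) hf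
  have h1 := (tendsto_calculusProj Φ hA hfx).inner (𝕜 := ℂ) (tendsto_calculusProj Φ hB hg)
  have h2 : Tendsto (fun n => Φ (realToComplex (f n) * realToComplex (g n)) y) atTop
      (𝓝 (calculusProj Φ (hA.inter hB) y)) := by
    refine tendsto_calculusProj Φ (hA.inter hB) ?_
    have h3 := hg.add hfy
    rw [add_zero] at h3
    refine tendsto_of_tendsto_of_tendsto_of_le_of_le tendsto_const_nhds h3
      (fun _ => zero_le) fun n => ?_
    set F := realToComplex (f n)
    set G := realToComplex (g n)
    -- In each term the first factor is bounded by `1` and the second tends to `0` in `L²(m_y)`.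
    have e : (⇑(F * G) - (A ∩ B).indicator fun _ => (1 : ℂ) : Circle → ℂ)
        = (fun z => F z * (G z - B.indicator (fun _ => (1 : ℂ)) z))
          + (fun z => B.indicator (fun _ => (1 : ℂ)) z
              * (F z - A.indicator (fun _ => (1 : ℂ)) z)) := by
      ext z
      by_cases hz : z ∈ A <;> by_cases hz' : z ∈ B <;> simp [hz, hz'] <;> ring
    have hmB : Measurable (B.indicator fun _ => (1 : ℂ)) := measurable_const.indicator hB
    have hmA : Measurable (A.indicator fun _ => (1 : ℂ)) := measurable_const.indicator hA
    rw [e]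
    refine (eLpNorm_add_le
      (F.continuous.measurable.mul (G.continuous.measurable.sub hmB)).aestronglyMeasurable
      (hmB.mul (F.continuous.measurable.sub hmA)).aestronglyMeasurable (by norm_num)).trans ?_
    refine add_le_add (eLpNorm_mono_ae (ae_of_all _ fun z => ?_))
      (eLpNorm_mono_ae (ae_of_all _ fun z => ?_))
    · rw [Pi.mul_apply, norm_mul]
      refine mul_le_of_le_one_left (norm_nonneg _) ?_
      change ‖((f n z : ℝ) : ℂ)‖ ≤ 1
      rw [Complex.norm_real]
      exact hf1 n z
    · rw [Pi.mul_apply, norm_mul]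
      refine mul_le_of_le_one_left (norm_nonneg _) ?_
      by_cases hz : z ∈ B <;> simp [hz]
  refine tendsto_nhds_unique h1 ((tendsto_const_nhds.inner h2).congr fun n => ?_)
  rw [inner_starHom_apply, star_realToComplex]

theorem inner_calculusProj_left {A : Set Circle} (hA : MeasurableSet A) (x y : H) :
    inner ℂ (calculusProj Φ hA x) y = inner ℂ x (calculusProj Φ hA y) := by
  have h := inner_calculusProj Φ hA MeasurableSet.univ x y
  rw [calculusProj_univ] at h
  rw [h]
  exact congrArg _ (calculusProj_congr Φ (Set.inter_univ A) _ _ y)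

theorem calculusProj_calculusProj {A B : Set Circle} (hA : MeasurableSet A) (hB : MeasurableSet B)
    (x : H) :
    calculusProj Φ hA (calculusProj Φ hB x) = calculusProj Φ (hA.inter hB) x := by
  refine ext_inner_left ℂ fun y => ?_
  rw [← inner_calculusProj_left, inner_calculusProj]

theorem enorm_calculusProj_le {A : Set Circle} (hA : MeasurableSet A) (x : H) :
    ‖calculusProj Φ hA x‖ₑ ≤ ‖x‖ₑ := by
  have h : ‖calculusProj Φ hA x‖ₑ ^ 2 ≤ ‖x‖ₑ ^ 2 := by
    conv_rhs => rw [← calculusProj_univ Φ x]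
    rw [enorm_calculusProj, enorm_calculusProj]
    exact measure_mono (Set.subset_univ _)
  exact (ENNReal.pow_right_strictMono two_ne_zero).le_iff_le.1 h

/-- The indicators of finite subunions converge in `L²(m_x)`, because the measure of what remains of
the union tends to `0`; `calculusExt` is continuous. -/
theorem hasSum_calculusProj {A : ℕ → Set Circle} (hA : ∀ k, MeasurableSet (A k))
    (hd : Pairwise (Function.onFun Disjoint A)) (x : H) :
    HasSum (fun k => calculusProj Φ (hA k) x) (calculusProj Φ (MeasurableSet.iUnion hA) x) := by
  refine HasSum.mapL (φ := calculusExt Φ x)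
    (f := fun k => indicatorConstLp 2 (hA k) (measure_ne_top _ _) 1) ?_
  have hF : ∀ F : Finset ℕ, MeasurableSet (⋃ k ∈ F, A k) := fun F =>
    F.measurableSet_biUnion fun k _ => hA k
  have hsum : ∀ F : Finset ℕ, (∑ k ∈ F, indicatorConstLp 2 (hA k)
      (measure_ne_top (calculusMeasure Φ x) _) (1 : ℂ))
      = indicatorConstLp 2 (hF F) (measure_ne_top _ _) 1 := by
    intro F
    refine Lp.ext ?_
    have hall : ∀ᵐ z ∂(calculusMeasure Φ x), ∀ k : ℕ, indicatorConstLp 2 (hA k)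
        (measure_ne_top (calculusMeasure Φ x) _) (1 : ℂ) z = (A k).indicator (fun _ => (1 : ℂ)) z :=
      ae_all_iff.2 fun k => indicatorConstLp_coeFn
    filter_upwards [Lp.coeFn_finsetSum F (fun k => indicatorConstLp 2 (hA k)
        (measure_ne_top (calculusMeasure Φ x) _) (1 : ℂ)),
      indicatorConstLp_coeFn (p := 2) (hs := hF F)
        (hμs := measure_ne_top (calculusMeasure Φ x) _) (c := (1 : ℂ)), hall] with z h1 h2 h3
    rw [h1, h2, Finset.sum_apply, Finset.indicator_biUnion]
    · exact Finset.sum_congr rfl fun k _ => h3 k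
    · exact fun i _ j _ hij => hd hij
  change Tendsto _ _ _
  simp only [hsum]
  refine tendsto_indicatorConstLp_set (by norm_num) ?_
  have hm : HasSum (fun k => calculusMeasure Φ x (A k)) (calculusMeasure Φ x (⋃ k, A k)) := by
    rw [measure_iUnion hd hA]
    exact ENNReal.summable.hasSum
  have h := ENNReal.Tendsto.sub (tendsto_const_nhds (x := calculusMeasure Φ x (⋃ k, A k)))
    hm (Or.inl (measure_ne_top _ _))
  rw [tsub_self] at h
  refine h.congr fun F => ?_
  have hsub : (⋃ k ∈ F, A k) ⊆ ⋃ k, A k := Set.iUnion₂_subset fun k _ => Set.subset_iUnion A k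
  rw [Set.symmDiff_def, Set.sdiff_eq_empty.2 hsub, Set.empty_union,
    measure_sdiff hsub (hF F).nullMeasurableSet (measure_ne_top _ _),
    measure_biUnion_finset (fun i _ j _ hij => hd hij) fun k _ => hA k]

open Classical in
/-- The projection-valued measure of a continuous functional calculus on the circle. -/
def calculusPVM : ProjValuedMeasure Circle H where
  proj A := if hA : MeasurableSet A then
      LinearMap.mkContinuous
        { toFun := calculusProj Φ hA
          map_add' := calculusProj_add Φ hA
          map_smul' := calculusProj_smul Φ hA } 1 (fun x => by
            rw [one_mul, ← toReal_enorm, ← toReal_enorm]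
            exact ENNReal.toReal_mono (by simp) (enorm_calculusProj_le Φ hA x))
    else 0
  isStarProjection A hA := by
    rw [dif_pos hA]
    refine ⟨?_, ?_⟩
    · ext x
      change calculusProj Φ hA (calculusProj Φ hA x) = calculusProj Φ hA x
      rw [calculusProj_calculusProj]
      exact calculusProj_congr Φ (Set.inter_self A) _ _ x
    · rw [ContinuousLinearMap.isSelfAdjoint_iff_isSymmetric]
      exact inner_calculusProj_left Φ hA
  not_measurable A hA := dif_neg hA
  proj_empty := by
    rw [dif_pos MeasurableSet.empty]
    ext x
    exact calculusProj_empty Φ x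
  proj_univ := by
    rw [dif_pos MeasurableSet.univ]
    ext x
    exact calculusProj_univ Φ x
  proj_mul_of_disjoint A B hA hB hd := by
    rw [dif_pos hA, dif_pos hB]
    ext x
    change calculusProj Φ hA (calculusProj Φ hB x) = 0
    rw [calculusProj_calculusProj, ← calculusProj_empty Φ x]
    exact calculusProj_congr Φ hd.inter_eq _ _ x
  hasSum_iUnion A hA hd x := by
    rw [dif_pos (MeasurableSet.iUnion hA)]
    simp only [dif_pos (hA _)]
    exact hasSum_calculusProj Φ hA hd x

theorem calculusPVM_proj {A : Set Circle} (hA : MeasurableSet A) (x : H) :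
    (calculusPVM Φ).proj A x = calculusProj Φ hA x := by
  simp only [calculusPVM, dif_pos hA]
  rfl

theorem calculusPVM_scalarMeasure (x : H) :
    (calculusPVM Φ).scalarMeasure x = calculusMeasure Φ x := by
  ext A hA
  rw [ProjValuedMeasure.scalarMeasure_apply' _ hA, calculusPVM_proj Φ hA, enorm_calculusProj]

theorem calculusPVM_simpleIntegral (s : SimpleFunc Circle ℂ) (x : H)
    (hs : MemLp s 2 (calculusMeasure Φ x)) :
    (calculusPVM Φ).simpleIntegral s x = calculusExt Φ x (hs.toLp s) := by
  have h : hs.toLp s = ∑ c ∈ s.range, c • indicatorConstLp 2 (s.measurableSet_fiber c)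
      (measure_ne_top (calculusMeasure Φ x) _) (1 : ℂ) := by
    refine Lp.ext ?_
    have hall : ∀ᵐ z ∂(calculusMeasure Φ x), ∀ c ∈ s.range,
        (c • indicatorConstLp 2 (s.measurableSet_fiber c)
          (measure_ne_top (calculusMeasure Φ x) _) (1 : ℂ) : Lp ℂ 2 (calculusMeasure Φ x)) z
          = c * (s ⁻¹' {c}).indicator (fun _ => (1 : ℂ)) z := by
      rw [Filter.eventually_all_finset]
      intro c _
      filter_upwards [Lp.coeFn_smul c (indicatorConstLp 2 (s.measurableSet_fiber c)
          (measure_ne_top (calculusMeasure Φ x) _) (1 : ℂ)),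
        indicatorConstLp_coeFn (p := 2) (hs := s.measurableSet_fiber c)
          (hμs := measure_ne_top (calculusMeasure Φ x) _) (c := (1 : ℂ))] with z h1 h2
      rw [h1, Pi.smul_apply, h2, smul_eq_mul]
    filter_upwards [hs.coeFn_toLp, Lp.coeFn_finsetSum s.range (fun c =>
        (c • indicatorConstLp 2 (s.measurableSet_fiber c)
          (measure_ne_top (calculusMeasure Φ x) _) (1 : ℂ) : Lp ℂ 2 (calculusMeasure Φ x))),
      hall] with z h1 h2 h3
    rw [h1, h2, Finset.sum_apply, Finset.sum_congr rfl h3,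
      Finset.sum_eq_single_of_mem (s z) (s.mem_range_self z)]
    · simp
    · intro c _ hc
      rw [Set.indicator_of_notMem (by simpa using hc.symm), mul_zero]
  rw [h, map_sum, ProjValuedMeasure.simpleIntegral, sum_apply]
  refine Finset.sum_congr rfl fun c _ => ?_
  rw [map_smul, smul_apply, calculusPVM_proj Φ (s.measurableSet_fiber c)]
  rfl

theorem calculusPVM_isIntegralAt (f : C(Circle, ℂ)) (x : H) :
    (calculusPVM Φ).IsIntegralAt f x (Φ f x) := by
  intro s hs
  rw [calculusPVM_scalarMeasure] at hs
  have hmem : ∀ n, MemLp (s n) 2 (calculusMeasure Φ x) := fun n =>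
    SimpleFunc.memLp_of_isFiniteMeasure _ _ _
  have h := (Lp.tendsto_Lp_iff_tendsto_eLpNorm'' _ hmem _
    (ProjValuedMeasure.memLp_continuousMap _ f)).2 hs
  have h2 := ((calculusExt Φ x).continuous.tendsto _).comp h
  rw [calculusExt_toLp] at h2
  exact h2.congr fun n => (calculusPVM_simpleIntegral Φ _ _ _).symm

end Calculus

/-! ### The spectral theorem for unitary operators -/

/-- The spectrum of a unitary lies on the circle, so functions on the circle restrict to it, along
`j`, and enter the continuous functional calculus of `U`. -/
theorem exists_starHom_circleCoe (U : H ≃ₗᵢ[ℂ] H) :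
    ∃ Φ : C(Circle, ℂ) →⋆ₐ[ℂ] (H →L[ℂ] H), Φ circleCoe = (U : H →L[ℂ] H) := by
  have hU : (U : H →L[ℂ] H) ∈ unitary (H →L[ℂ] H) :=
    (Unitary.linearIsometryEquiv.symm U).2
  have hn : IsStarNormal (U : H →L[ℂ] H) := by
    refine ⟨?_⟩
    rw [Commute, SemiconjBy, (Unitary.mem_iff.1 hU).1, (Unitary.mem_iff.1 hU).2]
  have hs := spectrum.subset_circle_of_unitary (𝕜 := ℂ) hU
  let j : C(spectrum ℂ (U : H →L[ℂ] H), Circle) :=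
    ⟨fun z => ⟨z, by simpa [Submonoid.unitSphere] using hs z.2⟩,
      Continuous.subtype_mk continuous_subtype_val fun z => by
        simpa [Submonoid.unitSphere] using hs z.2⟩
  refine ⟨(cfcHom hn).comp (ContinuousMap.compStarAlgHom' ℂ ℂ j), ?_⟩
  exact cfcHom_id hn

theorem exists_isSpectralMeasure (U : H ≃ₗᵢ[ℂ] H) :
    ∃ E : ProjValuedMeasure Circle H, IsSpectralMeasure U E := by
  obtain ⟨Φ, hΦ⟩ := exists_starHom_circleCoe U
  refine ⟨calculusPVM Φ, ?_⟩
  have hmem : ∀ x, MemLp (fun z : Circle => (z : ℂ)) 2 ((calculusPVM Φ).scalarMeasure x) :=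
    fun x => memLp_circle_coe _
  refine LinearPMap.ext ?_ ?_
  · ext x
    exact ⟨fun _ => trivial, fun _ => hmem x⟩
  · intro x hx hx'
    have h := (calculusPVM_isIntegralAt Φ circleCoe x).unique measurable_circle_coe (hmem x)
      ((calculusPVM Φ).isIntegralAt_integral (hf := measurable_circle_coe) ⟨x, hx⟩)
    rw [hΦ] at h
    exact h.symm

theorem existsUnique_isSpectralMeasure (U : H ≃ₗᵢ[ℂ] H) :
    ∃! E : ProjValuedMeasure Circle H, IsSpectralMeasure U E := by
  obtain ⟨E, hE⟩ := exists_isSpectralMeasure U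
  exact ⟨E, hE, fun F hF => hF.unique hE⟩

end

theorem theorem3p3 :
    (∃! U : L2Quarter ≃ₗᵢ[ℂ] L2Quarter, ScalesByFive U) ∧
    ∀ U : L2Quarter ≃ₗᵢ[ℂ] L2Quarter, ScalesByFive U →
      (∃! E : ProjValuedMeasure Circle L2Quarter, IsSpectralMeasure U E) ∧
      ∀ E : ProjValuedMeasure Circle L2Quarter, IsSpectralMeasure U E →
        ∀ v : L2Quarter, ‖v‖ = 1 →
          (cyclicSubspace U v : Set L2Quarter) =
            {w | ∃ (f : Circle → ℂ) (hf : Measurable f) (hv : MemLp f 2 (E.scalarMeasure v)),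
              E.integral f hf ⟨v, E.mem_domain_integral.2 hv⟩ = w} ∧
          ∃ R : Lp ℂ 2 (E.scalarMeasure v) ≃ₗᵢ[ℂ] cyclicSubspace U v,
            ∀ (f : Circle → ℂ) (hf : Measurable f) (hv : MemLp f 2 (E.scalarMeasure v)),
              (R (hv.toLp f) : L2Quarter) =
                E.integral f hf ⟨v, E.mem_domain_integral.2 hv⟩ :=
  ⟨existsUnique_scalesByFive, fun U _ => ⟨existsUnique_isSpectralMeasure U,
    fun _ hE v _ => ⟨hE.cyclicSubspace_eq v, hE.exists_isometryEquiv v⟩⟩⟩
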